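/- Let $d\in\mathbb N$, $\alpha=(\alpha_1,\dots,\alpha_d)\in(-1,\infty)^d$, and let $$d\mu_\alpha(x)=\prod_{i=1}^d\frac{x_i^{\alpha_i}e^{-x_i}}{\Gamma(\alpha_i+1)}\,dx$$ be the Laguerre measure on $\mathbb R_+^d=(0,\infty)^d$. Let $T_0^\alpha f=f$ and, for $t>0$, $T_t^\alpha f(x)=\int_{\mathbb R_+^d}G_t^\alpha(x,y)f(y)\,d\mu_\alpha(y)$ be the Laguerre semigroup, where $$G_t^\alpha(x,y)=\prod_{j=1}^d\frac{\Gamma(\alpha_j+1)}{1-e^{-t}}\,e^{-\frac{e^{-t}}{1-e^{-t}}(x_j+y_j)}\big(\sqrt{e^{-t}x_jy_j}\big)^{-\alpha_j}I_{\alpha_j}\Big(\frac{2\sqrt{e^{-t}x_jy_j}}{1-e^{-t}}\Big)$$ and $I_\nu$ is the modified Bessel function of the first kind of order $\nu$. Let $$P_t^\alpha f(x)=\frac1{\sqrt\pi}\int_0^\infty\frac{e^{-u}}{\sqrt u}\,T^\alpha_{t^2/(4u)}f(x)\,du\qquad(t\ge 0)$$ be the Poisson–Laguerre semigroup. For $\beta>0$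 let $n$ be the smallest integer greater than $\beta$. A (real- or complex-valued) function $f\in L^\infty(\mu_\alpha)$ belongs to the Laguerre Lipschitz space $Lip_\beta(\mu_\alpha)$ if there is a constant $A\ge 0$ such that $$\Big\|\frac{\partial^nP_t^\alpha f}{\partial t^n}\Big\|_\infty\le A\,t^{-n+\beta}\qquad\text{for all }t>0,$$ and $A_\beta(f)$ denotes the smallest such constant; here $\|\cdot\|_\infty$ is the norm of $L^\infty(\mu_\alpha)$. Proposition. If $0<\beta<1$ and $f\in Lip_\beta(\mu_\alpha)$, then for all $t\ge 0$ $$\|P_t^\alpha f-f\|_\infty\le\frac{A_\beta(f)}{\beta}\,t^\beta .$$ -/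

import Mathlib

open MeasureTheory
open scoped ENNReal Nat

noncomputable section

namespace Laguerre

/-- The open orthant `(0, ∞)^d` in `ℝ^d`. -/
def orthant (d : ℕ) : Set (Fin d → ℝ) :=
  {x | ∀ i, 0 < x i}

/-- The Laguerre probability measure
`dμ_α(x) = ∏ i, x_i ^ α_i * e^{-x_i} / Γ(α_i + 1) dx` on `(0, ∞)^d`,
as a measure on `ℝ^d` carried by the orthant. -/
def laguerreMeasure {d : ℕ} (α : Fin d → ℝ) : Measure (Fin d → ℝ) :=
  (volume.restrict (orthant d)).withDensity fun x =>
    ENNReal.ofReal (∏ i, x i ^ α i * Real.exp (-x i) / Real.Gamma (α i + 1))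

/-- The modified Bessel function of the first kind of order `ν`, for real `ν > -1` and `z > 0`:
`I_ν(z) = ∑ₖ (z / 2) ^ (2 k + ν) / (k! Γ(k + ν + 1))`. -/
def besselI (ν z : ℝ) : ℝ :=
  ∑' k : ℕ, (z / 2) ^ (2 * (k : ℝ) + ν) / ((k ! : ℝ) * Real.Gamma ((k : ℝ) + ν + 1))

/-- The heat kernel `G_t^α(x, y)`, `t > 0`, of the Laguerre semigroup with respect to `μ_α`. -/
def heatKernel {d : ℕ} (α : Fin d → ℝ) (t : ℝ) (x y : Fin d → ℝ) : ℝ :=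
  ∏ j, Real.Gamma (α j + 1) / (1 - Real.exp (-t)) *
    Real.exp (-(Real.exp (-t) / (1 - Real.exp (-t))) * (x j + y j)) *
    Real.sqrt (Real.exp (-t) * x j * y j) ^ (-α j) *
    besselI (α j) (2 * Real.sqrt (Real.exp (-t) * x j * y j) / (1 - Real.exp (-t)))

/-- The Laguerre semigroup: `T_0 f = f`, and
`T_t f(x) = ∫ G_t^α(x, y) f(y) dμ_α(y)` for `t > 0`. -/
def heatSemigroup {𝕜 : Type*} [RCLike 𝕜] {d : ℕ} (α : Fin d → ℝ) (t : ℝ)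
    (f : (Fin d → ℝ) → 𝕜) (x : Fin d → ℝ) : 𝕜 :=
  if t = 0 then f x else ∫ y, heatKernel α t x y • f y ∂(laguerreMeasure α)

/-- The Poisson-Laguerre semigroup, subordinated to the Laguerre semigroup:
`P_t f(x) = π^{-1/2} ∫_0^∞ e^{-u} u^{-1/2} T_{t²/(4u)} f(x) du`. -/
def poissonSemigroup {𝕜 : Type*} [RCLike 𝕜] {d : ℕ} (α : Fin d → ℝ) (t : ℝ)
    (f : (Fin d → ℝ) → 𝕜) (x : Fin d → ℝ) : 𝕜 :=
  (1 / Real.sqrt Real.pi) •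
    ∫ u in Set.Ioi (0 : ℝ), (Real.exp (-u) / Real.sqrt u) • heatSemigroup α (t ^ 2 / (4 * u)) f x

/-- `A` is an admissible constant for `f` in the Lipschitz condition of order `β`:
`‖∂_t^n P_t f‖_∞ ≤ A t^{-n+β}` for all `t > 0`, with `n = ⌊β⌋ + 1` the smallest integer greater
than `β`. The derivative is the pointwise one in `t`; for bounded `f` and `x` in the orthant the
function `t ↦ P_t f(x)` is smooth on `(0, ∞)`. -/
def IsLipBound {𝕜 : Type*} [RCLike 𝕜] {d : ℕ} (α : Fin d → ℝ) (β : ℝ)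
    (f : (Fin d → ℝ) → 𝕜) (A : ℝ) : Prop :=
  0 ≤ A ∧ ∀ t : ℝ, 0 < t →
    eLpNorm (fun x => iteratedDeriv (⌊β⌋₊ + 1) (fun s : ℝ => poissonSemigroup α s f x) t) ∞
        (laguerreMeasure α) ≤
      ENNReal.ofReal (A * t ^ (-((⌊β⌋₊ + 1 : ℕ) : ℝ) + β))

/-- Membership in the Laguerre Lipschitz space `Lip_β(μ_α)`: an `L^∞` function that has an
admissible constant. -/
def MemLip {𝕜 : Type*} [RCLike 𝕜] {d : ℕ} (α : Fin d → ℝ) (β : ℝ)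
    (f : (Fin d → ℝ) → 𝕜) : Prop :=
  MemLp f ∞ (laguerreMeasure α) ∧ ∃ A : ℝ, IsLipBound α β f A

/-- The constant `A_β(f)`: the smallest admissible constant in the Lipschitz condition. -/
def lipConst {𝕜 : Type*} [RCLike 𝕜] {d : ℕ} (α : Fin d → ℝ) (β : ℝ)
    (f : (Fin d → ℝ) → 𝕜) : ℝ :=
  sInf {A : ℝ | IsLipBound α β f A}

end Laguerre

end

/-!
Write `μ` for the Laguerre measure, `T_t` for the heat semigroup and `P_t` for the Poisson
semigroup. For almost every `x`, the Lipschitz condition bounds `∂_s P_s f(x)` by `A s^{β-1}`, and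
integrating this over `(s, t)` gives `|P_t f(x) - P_s f(x)| ≤ (A / β) t^β`. Letting `s → 0` and then
`A → A_β(f)` gives the claim. Two points need an argument.

* The exceptional null set in the Lipschitz condition depends on `s`. The substitution `u = s² v`
  writes `P_s f(x)` as `s / √π` times the Laplace transform, at `s²`, of
  `v^{-1/2} T_{1/(4v)} f(x)`. Hence `P_s f(x)` is continuously differentiable in `s`
  (`exists_hasDerivAt_poissonSemigroup`), and it suffices to collect the exceptional sets of
  rational times (`ae_norm_deriv_le`).

* `P_s f(x) → f(x)` almost everywhere along a sequence `s → 0`. This follows from convergence in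
  `L¹(μ)` (`tendsto_lintegral_enorm_poissonSemigroup_sub`), hence, by Tonelli's theorem and
  dominated convergence, from `∫∫ G_t(x, y) |f(y) - f(x)| dμ(y) dμ(x) → 0` as `t → 0`
  (`tendsto_heatOscillation`). As `G_t` is symmetric and Markovian, it is enough to treat
  continuous functions of compact support, for which Chebyshev's inequality reduces the matter to
  the mean squared displacement (`displacement_le`).

All facts on `G_t` are one-dimensional, since `μ` is a product of gamma distributions. In
dimension one, expanding the Bessel function shows that `G_t(x, ·) dμ` is a mixture of gamma
distributions with Poisson weights of mean `e^{-t} x / (1 - e^{-t})`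
(`enorm_heatFactor_mul_gammaPDF`); its total mass and first moment can then be read off.
-/

namespace Laguerre

open ProbabilityTheory Filter Topology

/-! ### The one-dimensional kernel as a Poisson mixture of gamma densities -/

/-- The one-dimensional Laguerre heat kernel, so that `heatKernel α t x y` is the product of the
`heatFactor (α j) t (x j) (y j)`. -/
noncomputable def heatFactor (a t x y : ℝ) : ℝ :=
  Real.Gamma (a + 1) / (1 - Real.exp (-t)) *
    Real.exp (-(Real.exp (-t) / (1 - Real.exp (-t))) * (x + y)) *
    Real.sqrt (Real.exp (-t) * x * y) ^ (-a) *
    besselI a (2 * Real.sqrt (Real.exp (-t) * x * y) / (1 - Real.exp (-t)))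

lemma one_sub_exp_neg_pos {t : ℝ} (ht : 0 < t) : 0 < 1 - Real.exp (-t) := by
  have : Real.exp (-t) < 1 := by rw [Real.exp_lt_one_iff]; linarith
  linarith

lemma heatFactor_comm (a t x y : ℝ) : heatFactor a t x y = heatFactor a t y x := by
  simp only [heatFactor, add_comm x y, mul_right_comm (Real.exp (-t)) x y]

lemma heatFactor_nonneg {a t : ℝ} (ha : -1 < a) (ht : 0 < t) (x y : ℝ) :
    0 ≤ heatFactor a t x y := by
  have hq1 := one_sub_exp_neg_pos ht
  have hG := Real.Gamma_pos_of_pos (s := a + 1) (by linarith)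
  have hB : 0 ≤ besselI a (2 * Real.sqrt (Real.exp (-t) * x * y) / (1 - Real.exp (-t))) :=
    tsum_nonneg fun k => by
      have := Real.Gamma_pos_of_pos (s := (k : ℝ) + a + 1)
        (by have : (0 : ℝ) ≤ k := k.cast_nonneg
            linarith)
      positivity
  unfold heatFactor
  positivity

lemma heatKernel_eq_prod {d : ℕ} (α : Fin d → ℝ) (t : ℝ) (x y : Fin d → ℝ) :
    heatKernel α t x y = ∏ j, heatFactor (α j) t (x j) (y j) := rfl

lemma measurable_besselI (ν : ℝ) : Measurable (besselI ν) := by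
  unfold besselI
  refine Measurable.tsum fun k => ?_
  fun_prop

lemma measurable_heatFactor (a : ℝ) :
    Measurable fun p : ℝ × ℝ × ℝ => heatFactor a p.1 p.2.1 p.2.2 := by
  have := measurable_besselI a
  unfold heatFactor
  fun_prop

/-- The Poisson weight `e^{-l} l^k / k!`. -/
noncomputable def poissonWeight (l : ℝ) (k : ℕ) : ℝ := Real.exp (-l) * l ^ k / (k ! : ℝ)

lemma poissonWeight_nonneg {l : ℝ} (hl : 0 ≤ l) (k : ℕ) : 0 ≤ poissonWeight l k := by
  unfold poissonWeight; positivity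

lemma tsum_poissonWeight {l : ℝ} (hl : 0 ≤ l) :
    ∑' k, ENNReal.ofReal (poissonWeight l k) = 1 := by
  have h := hasSum_one_poissonMeasure ⟨l, hl⟩
  have h' : HasSum (poissonWeight l) 1 := h
  rw [← ENNReal.ofReal_tsum_of_nonneg (poissonWeight_nonneg hl) h'.summable, h'.tsum_eq,
    ENNReal.ofReal_one]

lemma poissonWeight_succ_mul (l : ℝ) (k : ℕ) :
    poissonWeight l (k + 1) * ((k : ℝ) + 1) = l * poissonWeight l k := by
  unfold poissonWeight
  rw [Nat.factorial_succ]
  push_cast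
  have : (k ! : ℝ) ≠ 0 := by positivity
  have : (k : ℝ) + 1 ≠ 0 := by positivity
  field_simp
  ring

/-- Each term of the Bessel series in the kernel, multiplied by the density of the Laguerre
measure, is a Poisson weight times a gamma density. -/
lemma bessel_term_mul_gammaPDFReal {a t x y : ℝ} (ha : -1 < a) (ht : 0 < t) (hx : 0 < x)
    (hy : 0 < y) (k : ℕ) :
    Real.Gamma (a + 1) / (1 - Real.exp (-t)) *
        Real.exp (-(Real.exp (-t) / (1 - Real.exp (-t))) * (x + y)) *
        Real.sqrt (Real.exp (-t) * x * y) ^ (-a) *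
        ((2 * Real.sqrt (Real.exp (-t) * x * y) / (1 - Real.exp (-t)) / 2) ^ (2 * (k : ℝ) + a) /
          ((k ! : ℝ) * Real.Gamma ((k : ℝ) + a + 1))) * gammaPDFReal (a + 1) 1 y =
      poissonWeight (Real.exp (-t) * x / (1 - Real.exp (-t))) k *
        gammaPDFReal (k + a + 1) (1 / (1 - Real.exp (-t))) y := by
  set q := Real.exp (-t) with hq
  have hq0 : 0 < q := Real.exp_pos _
  have hq1 : 0 < 1 - q := one_sub_exp_neg_pos ht
  set s := Real.sqrt (q * x * y) with hs
  have hs0 : 0 < s := Real.sqrt_pos.2 (by positivity)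
  have hss : s ^ 2 = q * x * y := Real.sq_sqrt (by positivity)
  have hG1 : Real.Gamma (a + 1) ≠ 0 := (Real.Gamma_pos_of_pos (by linarith)).ne'
  have hG2 : Real.Gamma ((k : ℝ) + a + 1) ≠ 0 :=
    (Real.Gamma_pos_of_pos (by have : (0 : ℝ) ≤ k := k.cast_nonneg; linarith)).ne'
  have e1 : (2 * s / (1 - q) / 2) ^ (2 * (k : ℝ) + a)
      = (q * x * y) ^ k / ((1 - q) ^ k) ^ 2 * (s ^ a / (1 - q) ^ a) := by
    rw [show 2 * s / (1 - q) / 2 = s / (1 - q) by ring, Real.rpow_add (by positivity),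
      Real.div_rpow hs0.le hq1.le a, ← hss]
    congr 1
    rw [show 2 * (k : ℝ) = ((2 * k : ℕ) : ℝ) by push_cast; ring, Real.rpow_natCast, div_pow,
      pow_mul, ← pow_mul (1 - q) k 2, mul_comm k 2]
  have e2 : (1 / (1 - q)) ^ ((k : ℝ) + a + 1) = 1 / ((1 - q) ^ k * (1 - q) ^ a * (1 - q)) := by
    rw [Real.div_rpow zero_le_one hq1.le, Real.one_rpow, Real.rpow_add hq1, Real.rpow_add hq1,
      Real.rpow_natCast, Real.rpow_one]
  have e3 : y ^ ((k : ℝ) + a + 1 - 1) = y ^ k * y ^ a := by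
    rw [add_sub_cancel_right, Real.rpow_add hy, Real.rpow_natCast]
  have e4 : Real.exp (-(q / (1 - q)) * (x + y)) * Real.exp (-(1 * y))
      = Real.exp (-(q * x / (1 - q))) * Real.exp (-(1 / (1 - q) * y)) := by
    rw [← Real.exp_add, ← Real.exp_add]
    congr 1
    field_simp
    ring
  rw [gammaPDFReal, gammaPDFReal, if_pos hy.le, if_pos hy.le, e1, e2, e3, poissonWeight,
    Real.one_rpow, add_sub_cancel_right, Real.rpow_neg hs0.le]
  have h1 : s ^ a ≠ 0 := (Real.rpow_pos_of_pos hs0 a).ne'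
  have h2 : (1 - q) ^ a ≠ 0 := (Real.rpow_pos_of_pos hq1 a).ne'
  have h3 : (k ! : ℝ) ≠ 0 := by positivity
  calc _ = (Real.exp (-(q / (1 - q)) * (x + y)) * Real.exp (-(1 * y))) *
        ((q * x * y) ^ k / ((1 - q) ^ k) ^ 2 / (1 - q) ^ a / (1 - q) /
          ((k ! : ℝ) * Real.Gamma ((k : ℝ) + a + 1)) * y ^ a) := by field_simp
    _ = _ := by
      rw [e4, div_pow (q * x), mul_pow (q * x) y]
      field_simp

lemma gammaPDF_mul_ofReal {b r : ℝ} (hb : 0 < b) (hr : 0 < r) (y : ℝ) :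
    gammaPDF b r y * ENNReal.ofReal y = ENNReal.ofReal (b / r) * gammaPDF (b + 1) r y := by
  rcases lt_or_ge y 0 with hy | hy
  · simp [gammaPDF_of_neg hy]
  have hG := (Real.Gamma_pos_of_pos hb).ne'
  rw [gammaPDF_of_nonneg hy, gammaPDF_of_nonneg hy, ← ENNReal.ofReal_mul' hy,
    ← ENNReal.ofReal_mul (by positivity)]
  congr 1
  rcases hy.eq_or_lt with rfl | hy
  · rw [add_sub_cancel_right, Real.zero_rpow hb.ne']
    simp
  rw [Real.Gamma_add_one hb.ne', Real.rpow_add_one hr.ne', add_sub_cancel_right,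
    show y ^ b = y ^ (b - 1) * y by rw [← Real.rpow_add_one hy.ne', sub_add_cancel]]
  field_simp

lemma measurable_gammaPDF (b r : ℝ) : Measurable (gammaPDF b r) :=
  (measurable_gammaPDFReal b r).ennreal_ofReal

lemma lintegral_gammaMeasure (b r : ℝ) {h : ℝ → ℝ≥0∞} (hh : Measurable h) :
    ∫⁻ y, h y ∂gammaMeasure b r = ∫⁻ y, gammaPDF b r y * h y := by
  rw [gammaMeasure, lintegral_withDensity_eq_lintegral_mul _ (measurable_gammaPDF b r) hh]
  rfl

lemma lintegral_gammaPDF_mul_ofReal {b r : ℝ} (hb : 0 < b) (hr : 0 < r) :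
    ∫⁻ y, gammaPDF b r y * ENNReal.ofReal y = ENNReal.ofReal (b / r) := by
  simp_rw [gammaPDF_mul_ofReal hb hr]
  rw [lintegral_const_mul _ (measurable_gammaPDF _ _), lintegral_gammaPDF_eq_one (by linarith) hr,
    mul_one]

lemma ae_gammaMeasure_pos (b r : ℝ) : ∀ᵐ x ∂gammaMeasure b r, 0 < x := by
  rw [gammaMeasure, ae_withDensity_iff (measurable_gammaPDF b r)]
  have h0 : ∀ᵐ x : ℝ, x ≠ 0 := by simp [ae_iff]
  filter_upwards [h0] with x hx hp
  by_contra hneg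
  exact hp (gammaPDF_of_neg (lt_of_le_of_ne (not_lt.1 hneg) hx))

/-- For fixed `x > 0` the heat kernel times the density of the Laguerre measure is the density
of a Poisson mixture of gamma distributions. -/
lemma enorm_heatFactor_mul_gammaPDF {a t x : ℝ} (ha : -1 < a) (ht : 0 < t) (hx : 0 < x) :
    ∀ᵐ y : ℝ, gammaPDF (a + 1) 1 y * ‖heatFactor a t x y‖ₑ =
      ∑' k : ℕ, ENNReal.ofReal (poissonWeight (Real.exp (-t) * x / (1 - Real.exp (-t))) k) *
        gammaPDF (k + a + 1) (1 / (1 - Real.exp (-t))) y := by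
  have hq1 := one_sub_exp_neg_pos ht
  have hl : 0 ≤ Real.exp (-t) * x / (1 - Real.exp (-t)) := by positivity
  have hk : ∀ k : ℕ, 0 < (k : ℝ) + a + 1 := fun k => by
    have : (0 : ℝ) ≤ k := k.cast_nonneg
    linarith
  -- the mixture has total mass one, hence is finite almost everywhere
  have hfin : ∀ᵐ y : ℝ, ∑' k : ℕ, ENNReal.ofReal
      (poissonWeight (Real.exp (-t) * x / (1 - Real.exp (-t))) k) *
        gammaPDF (k + a + 1) (1 / (1 - Real.exp (-t))) y < ∞ := by
    refine ae_lt_top (Measurable.tsum fun k => (measurable_gammaPDF _ _).const_mul _) ?_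
    rw [lintegral_tsum fun k => ((measurable_gammaPDF _ _).const_mul _).aemeasurable]
    simp_rw [lintegral_const_mul _ (measurable_gammaPDF _ _),
      lintegral_gammaPDF_eq_one (hk _) (one_div_pos.2 hq1), mul_one, tsum_poissonWeight hl]
    exact ENNReal.one_ne_top
  have h0 : ∀ᵐ y : ℝ, y ≠ 0 := by simp [ae_iff]
  filter_upwards [hfin, h0] with y hy hy0
  rcases lt_or_gt_of_ne hy0 with hneg | hpos
  · simp [gammaPDF_of_neg hneg]
  have hterm := bessel_term_mul_gammaPDFReal ha ht hx hpos
  have hnn : ∀ k : ℕ, 0 ≤ poissonWeight (Real.exp (-t) * x / (1 - Real.exp (-t))) k *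
        gammaPDFReal (k + a + 1) (1 / (1 - Real.exp (-t))) y := fun k =>
    mul_nonneg (poissonWeight_nonneg hl k) (gammaPDFReal_nonneg (hk k) (one_div_pos.2 hq1) y)
  have hof : ∀ k : ℕ, ENNReal.ofReal (poissonWeight (Real.exp (-t) * x / (1 - Real.exp (-t))) k) *
        gammaPDF (k + a + 1) (1 / (1 - Real.exp (-t))) y =
      ENNReal.ofReal (poissonWeight (Real.exp (-t) * x / (1 - Real.exp (-t))) k *
        gammaPDFReal (k + a + 1) (1 / (1 - Real.exp (-t))) y) := fun k => by
    rw [gammaPDF, ENNReal.ofReal_mul (poissonWeight_nonneg hl k)]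
  simp_rw [hof] at hy ⊢
  have hsum := ENNReal.summable_toReal hy.ne
  simp_rw [ENNReal.toReal_ofReal (hnn _)] at hsum
  rw [← ENNReal.ofReal_tsum_of_nonneg hnn hsum]
  simp_rw [← hterm]
  rw [tsum_mul_right, tsum_mul_left]
  change _ = ENNReal.ofReal (heatFactor a t x y * gammaPDFReal (a + 1) 1 y)
  have hg : 0 ≤ gammaPDFReal (a + 1) 1 y := gammaPDFReal_nonneg (by linarith) one_pos y
  have hH := heatFactor_nonneg ha ht x y
  rw [Real.enorm_of_nonneg hH, gammaPDF, mul_comm, ENNReal.ofReal_mul hH]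

lemma measurable_enorm_heatFactor (a t x : ℝ) : Measurable fun y => ‖heatFactor a t x y‖ₑ :=
  ((measurable_heatFactor a).comp (by fun_prop : Measurable fun y : ℝ => (t, x, y))).enorm

lemma lintegral_enorm_heatFactor_mul {a t x : ℝ} (ha : -1 < a) (ht : 0 < t) (hx : 0 < x)
    {h : ℝ → ℝ≥0∞} (hh : Measurable h) :
    ∫⁻ y, ‖heatFactor a t x y‖ₑ * h y ∂gammaMeasure (a + 1) 1 =
      ∑' k : ℕ, ENNReal.ofReal (poissonWeight (Real.exp (-t) * x / (1 - Real.exp (-t))) k) *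
        ∫⁻ y, gammaPDF (k + a + 1) (1 / (1 - Real.exp (-t))) y * h y := by
  have hK := measurable_enorm_heatFactor a t x
  rw [lintegral_gammaMeasure _ _ (h := fun y => ‖heatFactor a t x y‖ₑ * h y) (by fun_prop)]
  simp_rw [← mul_assoc]
  rw [lintegral_congr_ae ((enorm_heatFactor_mul_gammaPDF ha ht hx).mono fun y hy => by
    simp only [hy]; exact ENNReal.tsum_mul_right.symm),
    lintegral_tsum]
  swap
  · exact fun k => (((measurable_gammaPDF _ _).const_mul _).mul hh).aemeasurable
  congr 1 with k
  simp_rw [mul_assoc]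
  exact lintegral_const_mul _ ((measurable_gammaPDF _ _).mul hh)

/-- The one-dimensional kernel is Markovian. -/
lemma lintegral_enorm_heatFactor {a t x : ℝ} (ha : -1 < a) (ht : 0 < t) (hx : 0 < x) :
    ∫⁻ y, ‖heatFactor a t x y‖ₑ ∂gammaMeasure (a + 1) 1 = 1 := by
  have hq1 := one_sub_exp_neg_pos ht
  have h := lintegral_enorm_heatFactor_mul ha ht hx (h := fun _ => 1) measurable_const
  simp only [mul_one] at h
  have hk : ∀ k : ℕ, 0 < (k : ℝ) + a + 1 := fun k => by
    have : (0 : ℝ) ≤ k := k.cast_nonneg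
    linarith
  rw [h]
  simp_rw [lintegral_gammaPDF_eq_one (hk _) (one_div_pos.2 hq1), mul_one]
  exact tsum_poissonWeight (by positivity)

/-- Lower bound for the first moment of the kernel; the exact value is
`e^{-t} x + (a + 1) (1 - e^{-t})`. -/
lemma le_lintegral_enorm_heatFactor_mul_ofReal {a t x : ℝ} (ha : -1 < a) (ht : 0 < t)
    (hx : 0 < x) :
    ENNReal.ofReal (Real.exp (-t) * x) ≤
      ∫⁻ y, ‖heatFactor a t x y‖ₑ * ENNReal.ofReal y ∂gammaMeasure (a + 1) 1 := by
  have hq1 := one_sub_exp_neg_pos ht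
  set q := Real.exp (-t) with hq
  have hq0 : 0 < q := Real.exp_pos _
  have hl : 0 ≤ q * x / (1 - q) := by positivity
  have hk : ∀ k : ℕ, 0 < (k : ℝ) + a + 1 := fun k => by
    have : (0 : ℝ) ≤ k := k.cast_nonneg
    linarith
  rw [lintegral_enorm_heatFactor_mul ha ht hx ENNReal.measurable_ofReal, ← hq]
  simp_rw [lintegral_gammaPDF_mul_ofReal (hk _) (one_div_pos.2 hq1)]
  calc ENNReal.ofReal (q * x)
      = ∑' k : ℕ, ENNReal.ofReal (q * x) * ENNReal.ofReal (poissonWeight (q * x / (1 - q)) k) := by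
        rw [ENNReal.tsum_mul_left, tsum_poissonWeight hl, mul_one]
    _ ≤ ∑' k : ℕ, ENNReal.ofReal (poissonWeight (q * x / (1 - q)) (k + 1)) *
          ENNReal.ofReal ((((k + 1 : ℕ) : ℝ) + a + 1) / (1 / (1 - q))) := by
        refine ENNReal.tsum_le_tsum fun k => ?_
        rw [← ENNReal.ofReal_mul (by positivity),
          ← ENNReal.ofReal_mul (poissonWeight_nonneg hl _)]
        refine ENNReal.ofReal_le_ofReal ?_
        have h1 := poissonWeight_succ_mul (q * x / (1 - q)) k
        have h2 : q * x = q * x / (1 - q) * (1 - q) := by field_simp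
        have h3 := poissonWeight_nonneg hl (k + 1)
        have h4 : (((k + 1 : ℕ) : ℝ) + a + 1) / (1 / (1 - q)) =
          ((k : ℝ) + 1) * (1 - q) + (a + 1) * (1 - q) := by
          push_cast; field_simp; ring
        rw [h4]
        calc q * x * poissonWeight (q * x / (1 - q)) k
            = (q * x / (1 - q) * poissonWeight (q * x / (1 - q)) k) * (1 - q) := by
              field_simp
          _ = poissonWeight (q * x / (1 - q)) (k + 1) * (((k : ℝ) + 1) * (1 - q)) := by
              rw [← h1]; ring
          _ ≤ _ := by
              refine mul_le_mul_of_nonneg_left ?_ h3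
              nlinarith
    _ ≤ _ := ENNReal.tsum_comp_le_tsum_of_injective (add_left_injective 1)
        (fun k : ℕ => ENNReal.ofReal (poissonWeight (q * x / (1 - q)) k) *
          ENNReal.ofReal (((k : ℝ) + a + 1) / (1 / (1 - q))))

lemma lintegral_ofReal_sq_gammaMeasure {b : ℝ} (hb : 0 < b) :
    ∫⁻ x, ENNReal.ofReal x ^ 2 ∂gammaMeasure b 1 = ENNReal.ofReal (b * (b + 1)) := by
  rw [lintegral_gammaMeasure _ _ (by fun_prop)]
  have : ∀ y, gammaPDF b 1 y * ENNReal.ofReal y ^ 2 =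
      ENNReal.ofReal b * (gammaPDF (b + 1) 1 y * ENNReal.ofReal y) := fun y => by
    rw [pow_two, ← mul_assoc, gammaPDF_mul_ofReal hb one_pos, div_one, mul_assoc]
  simp_rw [this]
  rw [lintegral_const_mul _ (by have := measurable_gammaPDF (b + 1) 1; fun_prop),
    lintegral_gammaPDF_mul_ofReal (by linarith) one_pos, div_one, ENNReal.ofReal_mul hb.le]

/-- The mean squared displacement of the one-dimensional Laguerre process, started from its
stationary distribution. -/
noncomputable def displacement (a t : ℝ) : ℝ≥0∞ :=
  ∫⁻ x, ∫⁻ y, ‖heatFactor a t x y‖ₑ * ENNReal.ofReal ((y - x) ^ 2) ∂gammaMeasure (a + 1) 1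
    ∂gammaMeasure (a + 1) 1

/-- By symmetry of the kernel `x²` and `y²` have the same mean; expanding `(y - x)²` then leaves
only the correlation of `x` and `y`, which is bounded below through the first moment. -/
lemma displacement_le {a t : ℝ} (ha : -1 < a) (ht : 0 < t) :
    displacement a t ≤ ENNReal.ofReal (2 * ((a + 1) * (a + 2)) * (1 - Real.exp (-t))) := by
  have hb : 0 < a + 1 := by linarith
  have := isProbabilityMeasure_gammaMeasure hb one_pos
  have hpos := ae_gammaMeasure_pos (a + 1) 1
  have hm2 : ∫⁻ x, ENNReal.ofReal x ^ 2 ∂gammaMeasure (a + 1) 1 =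
      ENNReal.ofReal ((a + 1) * (a + 2)) := by
    rw [lintegral_ofReal_sq_gammaMeasure hb]; ring_nf
  set γ := gammaMeasure (a + 1) 1 with hγ
  have hK : Measurable fun p : ℝ × ℝ => ‖heatFactor a t p.1 p.2‖ₑ :=
    ((measurable_heatFactor a).comp
      (by fun_prop : Measurable fun p : ℝ × ℝ => (t, p.1, p.2))).enorm
  have hK1 : ∀ x, Measurable fun y => ‖heatFactor a t x y‖ₑ := measurable_enorm_heatFactor a t
  -- second moment of the starting point
  have hX : ∫⁻ x, ∫⁻ y, ‖heatFactor a t x y‖ₑ * ENNReal.ofReal x ^ 2 ∂γ ∂γ =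
      ENNReal.ofReal ((a + 1) * (a + 2)) := by
    rw [← hm2]
    refine lintegral_congr_ae (hpos.mono fun x hx => ?_)
    simp only
    rw [lintegral_mul_const _ (hK1 x), lintegral_enorm_heatFactor ha ht hx, one_mul]
  -- second moment of the end point
  have hY : ∫⁻ x, ∫⁻ y, ‖heatFactor a t x y‖ₑ * ENNReal.ofReal y ^ 2 ∂γ ∂γ =
      ENNReal.ofReal ((a + 1) * (a + 2)) := by
    rw [lintegral_lintegral_swap, ← hX]
    · simp_rw [heatFactor_comm a t]
    · exact (hK.mul (by fun_prop)).aemeasurable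
  have hXY : ENNReal.ofReal ((a + 1) * (a + 2) * Real.exp (-t)) ≤
      ∫⁻ x, ∫⁻ y, ‖heatFactor a t x y‖ₑ * (ENNReal.ofReal x * ENNReal.ofReal y) ∂γ ∂γ := by
    rw [ENNReal.ofReal_mul (by nlinarith), ← hm2, ← lintegral_mul_const _ (by fun_prop)]
    refine lintegral_mono_ae (hpos.mono fun x hx => ?_)
    have h1 := le_lintegral_enorm_heatFactor_mul_ofReal ha ht hx
    simp_rw [mul_left_comm _ (ENNReal.ofReal x)]
    have hm : Measurable fun y => ‖heatFactor a t x y‖ₑ * ENNReal.ofReal y :=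
      (hK1 x).mul (by fun_prop)
    rw [lintegral_const_mul _ hm, pow_two, mul_assoc]
    gcongr
    rwa [mul_comm, ← ENNReal.ofReal_mul (Real.exp_pos _).le]
  have hsum : displacement a t + 2 *
      ∫⁻ x, ∫⁻ y, ‖heatFactor a t x y‖ₑ * (ENNReal.ofReal x * ENNReal.ofReal y) ∂γ ∂γ =
      ENNReal.ofReal (2 * ((a + 1) * (a + 2))) := by
    rw [two_mul ((a + 1) * (a + 2)), ENNReal.ofReal_add (by nlinarith) (by nlinarith)]
    nth_rewrite 1 [← hX]
    rw [← hY, displacement, ← lintegral_const_mul, ← lintegral_add_right, ← lintegral_add_right]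
    · refine lintegral_congr_ae (hpos.mono fun x hx => ?_)
      simp only
      have hm : Measurable fun y =>
          ‖heatFactor a t x y‖ₑ * (ENNReal.ofReal x * ENNReal.ofReal y) :=
        (hK1 x).mul (by fun_prop)
      rw [← lintegral_const_mul _ hm, ← lintegral_add_right,
        ← lintegral_add_right]
      · refine lintegral_congr_ae (hpos.mono fun y hy => ?_)
        simp only
        rw [mul_left_comm, ← mul_add, ← mul_add]
        congr 1
        rw [← ENNReal.ofReal_pow hx.le, ← ENNReal.ofReal_pow hy.le, ← ENNReal.ofReal_mul hx.le,
          ← ENNReal.ofReal_ofNat 2, ← ENNReal.ofReal_mul zero_le_two,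
          ← ENNReal.ofReal_add (by positivity) (by positivity),
          ← ENNReal.ofReal_add (by positivity) (by positivity)]
        congr 1
        ring
      · exact (hK1 x).mul (by fun_prop)
      · exact hm.const_mul _
    · exact Measurable.lintegral_prod_right' (f := fun p : ℝ × ℝ =>
        ‖heatFactor a t p.1 p.2‖ₑ * ENNReal.ofReal p.2 ^ 2) (hK.mul (by fun_prop))
    · exact (Measurable.lintegral_prod_right' (f := fun p : ℝ × ℝ =>
        ‖heatFactor a t p.1 p.2‖ₑ * (ENNReal.ofReal p.1 * ENNReal.ofReal p.2))
        (hK.mul (by fun_prop))).const_mul _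
    · exact Measurable.lintegral_prod_right' (f := fun p : ℝ × ℝ =>
        ‖heatFactor a t p.1 p.2‖ₑ * (ENNReal.ofReal p.1 * ENNReal.ofReal p.2))
        (hK.mul (by fun_prop))
  have hle : displacement a t + ENNReal.ofReal (2 * ((a + 1) * (a + 2)) * Real.exp (-t)) ≤
      ENNReal.ofReal (2 * ((a + 1) * (a + 2))) := by
    rw [← hsum, mul_assoc, ENNReal.ofReal_mul zero_le_two, ENNReal.ofReal_ofNat]
    gcongr
  calc displacement a t ≤ ENNReal.ofReal (2 * ((a + 1) * (a + 2))) -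
        ENNReal.ofReal (2 * ((a + 1) * (a + 2)) * Real.exp (-t)) :=
        ENNReal.le_sub_of_add_le_right ENNReal.ofReal_ne_top hle
    _ = _ := by
        rw [← ENNReal.ofReal_sub _ (mul_nonneg (by nlinarith) (Real.exp_pos _).le)]
        congr 1
        ring

lemma tendsto_displacement {a : ℝ} (ha : -1 < a) :
    Tendsto (displacement a) (𝓝[>] 0) (𝓝 0) := by
  refine tendsto_of_tendsto_of_tendsto_of_le_of_le' tendsto_const_nhds ?_
    (Eventually.of_forall fun _ => zero_le)
    (eventually_mem_nhdsWithin.mono fun t ht => displacement_le ha ht)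
  have hc : Continuous fun t : ℝ =>
      ENNReal.ofReal (2 * ((a + 1) * (a + 2)) * (1 - Real.exp (-t))) :=
    ENNReal.continuous_ofReal.comp (by fun_prop)
  have := hc.tendsto 0
  simp only [neg_zero, Real.exp_zero, sub_self, mul_zero, ENNReal.ofReal_zero] at this
  exact this.mono_left nhdsWithin_le_nhds

/-! ### The Laguerre measure as a product of gamma distributions -/

/-- Tonelli's theorem for a product of functions of one coordinate each. -/
lemma lintegral_pi_prod {d : ℕ} (μ : Fin d → Measure ℝ) [∀ i, SigmaFinite (μ i)]
    (f : Fin d → ℝ → ℝ≥0∞) (hf : ∀ i, Measurable (f i)) :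
    ∫⁻ x, ∏ i, f i (x i) ∂Measure.pi μ = ∏ i, ∫⁻ x, f i x ∂μ i := by
  induction d with
  | zero => simp
  | succ n ih =>
    rw [← ((measurePreserving_piFinSuccAbove μ 0).symm).lintegral_comp_emb
      (MeasurableEquiv.measurableEmbedding _)]
    simp_rw [MeasurableEquiv.piFinSuccAbove_symm_apply, Fin.insertNthEquiv,
      Fin.prod_univ_succ, Fin.insertNth_zero, Equiv.coe_fn_mk, Fin.cons_succ,
      Fin.zero_succAbove, cast_eq, Fin.cons_zero]
    rw [← ih (fun i => μ i.succ) _ fun i => hf i.succ]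
    refine lintegral_prod_mul (ν := Measure.pi fun j : Fin n => μ j.succ)
      (g := fun y : Fin n → ℝ => ∏ i, f i.succ (y i))
      (hf 0).aemeasurable ?_
    exact (Finset.measurable_prod _ fun i _ => (hf _).comp (measurable_pi_apply i)).aemeasurable

lemma measurableSet_orthant (d : ℕ) : MeasurableSet (orthant d) := by
  have : orthant d = ⋂ i, (fun x : Fin d → ℝ => x i) ⁻¹' Set.Ioi 0 := by
    ext x; simp [orthant]
  rw [this]
  exact MeasurableSet.iInter fun i => measurable_pi_apply i measurableSet_Ioi

lemma laguerreMeasure_eq_pi {d : ℕ} {α : Fin d → ℝ} (hα : ∀ i, -1 < α i) :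
    laguerreMeasure α = Measure.pi fun i => gammaMeasure (α i + 1) 1 := by
  have hp : ∀ i, IsProbabilityMeasure (gammaMeasure (α i + 1) 1) := fun i =>
    isProbabilityMeasure_gammaMeasure (by linarith [hα i]) one_pos
  refine (Measure.pi_eq fun s hs => ?_).symm
  have hms : MeasurableSet (Set.univ.pi s) := MeasurableSet.univ_pi hs
  have key : ∀ x : Fin d → ℝ, (Set.univ.pi s).indicator ((orthant d).indicator fun x =>
      ENNReal.ofReal (∏ i, x i ^ α i * Real.exp (-x i) / Real.Gamma (α i + 1))) x =
      ∏ i, (s i).indicator ((Set.Ioi 0).indicator (gammaPDF (α i + 1) 1)) (x i) := by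
    intro x
    by_cases h1 : x ∈ Set.univ.pi s
    · by_cases h2 : x ∈ orthant d
      · rw [Set.indicator_of_mem h1, Set.indicator_of_mem h2, ENNReal.ofReal_prod_of_nonneg]
        · refine Finset.prod_congr rfl fun i _ => ?_
          rw [Set.indicator_of_mem (h1 i trivial), Set.indicator_of_mem (s := Set.Ioi 0) (h2 i),
            gammaPDF_of_nonneg (h2 i).le]
          simp only [Real.one_rpow, add_sub_cancel_right, one_mul]
          congr 1
          ring
        · intro i _
          have := h2 i
          have := Real.Gamma_pos_of_pos (s := α i + 1) (by linarith [hα i])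
          positivity
      · rw [Set.indicator_of_mem h1, Set.indicator_of_notMem h2]
        simp only [orthant, Set.mem_ofPred_eq, not_forall] at h2
        obtain ⟨i, hi⟩ := h2
        refine (Finset.prod_eq_zero (Finset.mem_univ i) ?_).symm
        rw [Set.indicator_of_mem (h1 i trivial), Set.indicator_of_notMem (s := Set.Ioi 0) hi]
    · rw [Set.indicator_of_notMem h1]
      simp only [Set.mem_pi, Set.mem_univ, forall_const, not_forall] at h1
      obtain ⟨i, hi⟩ := h1
      exact (Finset.prod_eq_zero (Finset.mem_univ i) (Set.indicator_of_notMem hi _)).symm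
  rw [laguerreMeasure, withDensity_apply _ hms, ← lintegral_indicator hms,
    ← lintegral_indicator (measurableSet_orthant d)]
  simp_rw [Set.indicator_indicator, Set.inter_comm (orthant d), ← Set.indicator_indicator, key]
  rw [volume_pi, lintegral_pi_prod]
  · refine Finset.prod_congr rfl fun i _ => ?_
    rw [lintegral_indicator (hs i), gammaMeasure, withDensity_apply _ (hs i)]
    refine setLIntegral_congr_fun_ae (hs i) ?_
    have h0 : ∀ᵐ x : ℝ, x ≠ 0 := by simp [ae_iff]
    filter_upwards [h0] with x hx _
    rcases lt_or_gt_of_ne hx with h | h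
    · rw [Set.indicator_of_notMem (by simpa using h.le), gammaPDF_of_neg h]
    · rw [Set.indicator_of_mem (by simpa using h)]
  · exact fun i => ((measurable_gammaPDF _ _).indicator measurableSet_Ioi).indicator (hs i)

lemma isProbabilityMeasure_laguerreMeasure {d : ℕ} {α : Fin d → ℝ} (hα : ∀ i, -1 < α i) :
    IsProbabilityMeasure (laguerreMeasure α) := by
  have hp : ∀ i, IsProbabilityMeasure (gammaMeasure (α i + 1) 1) := fun i =>
    isProbabilityMeasure_gammaMeasure (by linarith [hα i]) one_pos
  rw [laguerreMeasure_eq_pi hα]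
  infer_instance

lemma ae_mem_orthant {d : ℕ} (α : Fin d → ℝ) : ∀ᵐ x ∂laguerreMeasure α, x ∈ orthant d :=
  (withDensity_absolutelyContinuous _ _).ae_le (ae_restrict_mem (measurableSet_orthant d))

/-! ### The heat kernel in several variables -/

variable {d : ℕ} {α : Fin d → ℝ}

lemma heatKernel_comm (t : ℝ) (x y : Fin d → ℝ) : heatKernel α t x y = heatKernel α t y x := by
  simp only [heatKernel_eq_prod, heatFactor_comm _ t (x _) (y _)]

lemma measurable_heatKernel (α : Fin d → ℝ) :
    Measurable fun p : ℝ × (Fin d → ℝ) × (Fin d → ℝ) => heatKernel α p.1 p.2.1 p.2.2 := by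
  have h : ∀ j, Measurable fun p : ℝ × (Fin d → ℝ) × (Fin d → ℝ) =>
      heatFactor (α j) p.1 (p.2.1 j) (p.2.2 j) := fun j => by
    have h1 : Measurable fun p : ℝ × (Fin d → ℝ) × (Fin d → ℝ) => (p.1, p.2.1 j, p.2.2 j) := by
      fun_prop
    have h2 := (measurable_heatFactor (α j)).comp h1
    exact h2
  simp only [heatKernel_eq_prod]
  exact Finset.measurable_fun_prod _ fun j _ => h j

lemma measurable_heatKernel_right (α : Fin d → ℝ) (t : ℝ) (x : Fin d → ℝ) :
    Measurable (heatKernel α t x) := by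
  have h1 : Measurable fun y : Fin d → ℝ => (t, x, y) := by fun_prop
  have h2 := (measurable_heatKernel α).comp h1
  exact h2

lemma measurable_heatKernel_uncurry (α : Fin d → ℝ) (t : ℝ) :
    Measurable fun p : (Fin d → ℝ) × (Fin d → ℝ) => heatKernel α t p.1 p.2 := by
  have h1 : Measurable fun p : (Fin d → ℝ) × (Fin d → ℝ) => (t, p.1, p.2) := by fun_prop
  have h2 := (measurable_heatKernel α).comp h1
  exact h2

lemma enorm_heatKernel (t : ℝ) (x y : Fin d → ℝ) :
    ‖heatKernel α t x y‖ₑ = ∏ j, ‖heatFactor (α j) t (x j) (y j)‖ₑ := by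
  rw [heatKernel_eq_prod, enorm_eq_nnnorm, nnnorm_prod, ENNReal.ofNNReal_finsetProd]
  rfl

/-- The heat kernel is Markovian. -/
lemma lintegral_enorm_heatKernel (hα : ∀ i, -1 < α i) {t : ℝ} (ht : 0 < t) {x : Fin d → ℝ}
    (hx : x ∈ orthant d) : ∫⁻ y, ‖heatKernel α t x y‖ₑ ∂laguerreMeasure α = 1 := by
  have hp : ∀ i, IsProbabilityMeasure (gammaMeasure (α i + 1) 1) := fun i =>
    isProbabilityMeasure_gammaMeasure (by linarith [hα i]) one_pos
  simp_rw [enorm_heatKernel]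
  rw [laguerreMeasure_eq_pi hα,
    lintegral_pi_prod _ (fun j s => ‖heatFactor (α j) t (x j) s‖ₑ)
      fun j => measurable_enorm_heatFactor _ _ _]
  exact Finset.prod_eq_one fun j _ => lintegral_enorm_heatFactor (hα j) ht (hx j)

lemma lintegral_enorm_heatKernel_mul (hα : ∀ i, -1 < α i) {t : ℝ} (ht : 0 < t)
    {x : Fin d → ℝ} (hx : x ∈ orthant d) (j : Fin d) {h : ℝ → ℝ≥0∞} (hh : Measurable h) :
    ∫⁻ y, ‖heatKernel α t x y‖ₑ * h (y j) ∂laguerreMeasure α =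
      ∫⁻ s, ‖heatFactor (α j) t (x j) s‖ₑ * h s ∂gammaMeasure (α j + 1) 1 := by
  have hp : ∀ i, IsProbabilityMeasure (gammaMeasure (α i + 1) 1) := fun i =>
    isProbabilityMeasure_gammaMeasure (by linarith [hα i]) one_pos
  have hprod : ∀ y : Fin d → ℝ, ‖heatKernel α t x y‖ₑ * h (y j) =
      ∏ i, ‖heatFactor (α i) t (x i) (y i)‖ₑ * if i = j then h (y i) else 1 := fun y => by
    rw [Finset.prod_mul_distrib, enorm_heatKernel, Finset.prod_ite_eq' Finset.univ j,
      if_pos (Finset.mem_univ j)]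
  simp_rw [hprod]
  rw [laguerreMeasure_eq_pi hα, lintegral_pi_prod _
    (fun i s => ‖heatFactor (α i) t (x i) s‖ₑ * if i = j then h s else 1)]
  · rw [Finset.prod_eq_single j]
    · simp
    · intro i _ hij
      simp only [if_neg hij, mul_one]
      exact lintegral_enorm_heatFactor (hα i) ht (hx i)
    · simp
  · intro i
    refine (measurable_enorm_heatFactor _ _ _).mul ?_
    split_ifs
    · exact hh
    · exact measurable_const

lemma heatKernel_nonneg (hα : ∀ i, -1 < α i) {t : ℝ} (ht : 0 < t) (x y : Fin d → ℝ) :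
    0 ≤ heatKernel α t x y :=
  Finset.prod_nonneg fun j _ => heatFactor_nonneg (hα j) ht _ _

lemma integrable_heatKernel (hα : ∀ i, -1 < α i) {t : ℝ} (ht : 0 < t) {x : Fin d → ℝ}
    (hx : x ∈ orthant d) : Integrable (heatKernel α t x) (laguerreMeasure α) :=
  ⟨(measurable_heatKernel_right α t x).aestronglyMeasurable, by
    rw [HasFiniteIntegral, lintegral_enorm_heatKernel hα ht hx]
    exact ENNReal.one_lt_top⟩

lemma integral_heatKernel (hα : ∀ i, -1 < α i) {t : ℝ} (ht : 0 < t) {x : Fin d → ℝ}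
    (hx : x ∈ orthant d) : ∫ y, heatKernel α t x y ∂laguerreMeasure α = 1 := by
  rw [integral_eq_lintegral_of_nonneg_ae
    (Eventually.of_forall fun y => heatKernel_nonneg hα ht x y)
    (measurable_heatKernel_right α t x).aestronglyMeasurable,
    ← lintegral_enorm_of_nonneg fun y => heatKernel_nonneg hα ht x y,
    lintegral_enorm_heatKernel hα ht hx, ENNReal.toReal_one]

/-! ### Mean oscillation of a function along the heat flow -/

variable {𝕜 : Type*} [RCLike 𝕜]

/-- The mean oscillation `∫∫ G_t(x, y) |f(y) - f(x)| dμ(y) dμ(x)`, which dominates the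
`L¹` distance between `T_t f` and `f`. -/
noncomputable def heatOscillation (α : Fin d → ℝ) (f : (Fin d → ℝ) → 𝕜) (t : ℝ) : ℝ≥0∞ :=
  ∫⁻ x, ∫⁻ y, ‖heatKernel α t x y‖ₑ * ‖f y - f x‖ₑ ∂laguerreMeasure α ∂laguerreMeasure α

lemma lintegral_lintegral_enorm_heatKernel_mul_left (hα : ∀ i, -1 < α i) {t : ℝ} (ht : 0 < t)
    (h : (Fin d → ℝ) → ℝ≥0∞) :
    ∫⁻ x, ∫⁻ y, ‖heatKernel α t x y‖ₑ * h x ∂laguerreMeasure α ∂laguerreMeasure α =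
      ∫⁻ x, h x ∂laguerreMeasure α := by
  refine lintegral_congr_ae ((ae_mem_orthant α).mono fun x hx => ?_)
  simp only
  rw [lintegral_mul_const _ (measurable_heatKernel_right α t x).enorm,
    lintegral_enorm_heatKernel hα ht hx, one_mul]

lemma lintegral_lintegral_enorm_heatKernel_mul_right (hα : ∀ i, -1 < α i) {t : ℝ} (ht : 0 < t)
    {h : (Fin d → ℝ) → ℝ≥0∞} (hh : Measurable h) :
    ∫⁻ x, ∫⁻ y, ‖heatKernel α t x y‖ₑ * h y ∂laguerreMeasure α ∂laguerreMeasure α =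
      ∫⁻ x, h x ∂laguerreMeasure α := by
  have := isProbabilityMeasure_laguerreMeasure hα
  have hK := (measurable_heatKernel_uncurry α t).enorm
  rw [lintegral_lintegral_swap]
  · simp_rw [heatKernel_comm (α := α) t]
    exact lintegral_lintegral_enorm_heatKernel_mul_left hα ht h
  · exact (hK.mul (hh.comp measurable_snd)).aemeasurable

lemma measurable_lintegral_heatKernel_mul (hα : ∀ i, -1 < α i) (t : ℝ)
    {h : (Fin d → ℝ) × (Fin d → ℝ) → ℝ≥0∞} (hh : Measurable h) :
    Measurable fun x => ∫⁻ y, ‖heatKernel α t x y‖ₑ * h (x, y) ∂laguerreMeasure α := by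
  have := isProbabilityMeasure_laguerreMeasure hα
  have hK := (measurable_heatKernel_uncurry α t).enorm
  exact Measurable.lintegral_prod_right' (f := fun p : (Fin d → ℝ) × (Fin d → ℝ) =>
    ‖heatKernel α t p.1 p.2‖ₑ * h p) (hK.mul hh)

/-- The heat flow contracts `L¹`, so the mean oscillation is stable under `L¹` perturbations. -/
lemma heatOscillation_le_add (hα : ∀ i, -1 < α i) {t : ℝ} (ht : 0 < t)
    {f g : (Fin d → ℝ) → 𝕜} (hf : StronglyMeasurable f) (hg : StronglyMeasurable g) :
    heatOscillation α f t ≤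
      heatOscillation α g t + 2 * ∫⁻ x, ‖f x - g x‖ₑ ∂laguerreMeasure α := by
  have hfg : Measurable fun x => ‖f x - g x‖ₑ := (hf.sub hg).enorm
  have hK : ∀ x, Measurable fun y => ‖heatKernel α t x y‖ₑ := fun x =>
    (measurable_heatKernel_right α t x).enorm
  rw [two_mul]
  nth_rewrite 1 [← lintegral_lintegral_enorm_heatKernel_mul_right hα ht hfg]
  rw [← lintegral_lintegral_enorm_heatKernel_mul_left hα ht fun x => ‖f x - g x‖ₑ,
    heatOscillation, heatOscillation, ← lintegral_add_left, ← lintegral_add_right]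
  · refine lintegral_mono fun x => ?_
    have hm : Measurable fun y => ‖heatKernel α t x y‖ₑ * ‖f y - g y‖ₑ := (hK x).mul hfg
    rw [← lintegral_add_left hm, ← lintegral_add_right]
    · refine lintegral_mono fun y => ?_
      simp only
      rw [← mul_add, ← mul_add]
      gcongr
      calc ‖f y - f x‖ₑ = ‖(g y - g x) + ((f y - g y) - (f x - g x))‖ₑ := by
            congr 1; ring
        _ ≤ ‖g y - g x‖ₑ + ‖(f y - g y) - (f x - g x)‖ₑ := enorm_add_le _ _
        _ ≤ _ := by gcongr; exact enorm_sub_le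
    · exact hm.add ((hK x).mul_const _)
  · exact (measurable_lintegral_heatKernel_mul hα t (h := fun p => ‖f p.2 - g p.2‖ₑ)
      (hfg.comp measurable_snd)).add (measurable_lintegral_heatKernel_mul hα t
        (h := fun p => ‖f p.1 - g p.1‖ₑ) (hfg.comp measurable_fst))
  · exact measurable_lintegral_heatKernel_mul hα t (h := fun p => ‖f p.2 - g p.2‖ₑ)
      (hfg.comp measurable_snd)

lemma heatOscillation_le (hα : ∀ i, -1 < α i) {t : ℝ} (ht : 0 < t)
    {f : (Fin d → ℝ) → 𝕜} (hf : StronglyMeasurable f) :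
    heatOscillation α f t ≤ 2 * ∫⁻ x, ‖f x‖ₑ ∂laguerreMeasure α := by
  have h := heatOscillation_le_add hα ht hf (g := fun _ => (0 : 𝕜)) stronglyMeasurable_const
  simpa [heatOscillation] using h

/-- Chebyshev's inequality: the oscillation of a bounded function is controlled by its modulus of
continuity and by the mean squared displacement. -/
lemma heatOscillation_le_displacement (hα : ∀ i, -1 < α i) {t : ℝ} (ht : 0 < t)
    {g : (Fin d → ℝ) → 𝕜} {ε C : ℝ≥0∞}
    (hg : ∀ x y, ‖g y - g x‖ₑ ≤ ε + C * ∑ j, ENNReal.ofReal ((y j - x j) ^ 2)) :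
    heatOscillation α g t ≤ ε + C * ∑ j, displacement (α j) t := by
  have hp : ∀ i, IsProbabilityMeasure (gammaMeasure (α i + 1) 1) := fun i =>
    isProbabilityMeasure_gammaMeasure (by linarith [hα i]) one_pos
  have hμ := isProbabilityMeasure_laguerreMeasure hα
  have hK : ∀ x, Measurable fun y => ‖heatKernel α t x y‖ₑ := fun x =>
    (measurable_heatKernel_right α t x).enorm
  have hinner : ∀ x ∈ orthant d, ∫⁻ y, ‖heatKernel α t x y‖ₑ * ‖g y - g x‖ₑ ∂laguerreMeasure α ≤
      ε + C * ∑ j, ∫⁻ s, ‖heatFactor (α j) t (x j) s‖ₑ * ENNReal.ofReal ((s - x j) ^ 2)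
        ∂gammaMeasure (α j + 1) 1 := by
    intro x hx
    calc _ ≤ ∫⁻ y, ‖heatKernel α t x y‖ₑ * ε + C * ∑ j, ‖heatKernel α t x y‖ₑ *
          ENNReal.ofReal ((y j - x j) ^ 2) ∂laguerreMeasure α := by
          refine lintegral_mono fun y => ?_
          simp only
          rw [← Finset.mul_sum, mul_left_comm, ← mul_add]
          gcongr
          exact hg x y
      _ = _ := by
          rw [lintegral_add_left ((hK x).mul_const _), lintegral_mul_const _ (hK x),
            lintegral_enorm_heatKernel hα ht hx, one_mul, lintegral_const_mul,
            lintegral_finsetSum]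
          · congr 3 with j
            exact lintegral_enorm_heatKernel_mul hα ht hx j
              (h := fun s => ENNReal.ofReal ((s - x j) ^ 2)) (by fun_prop)
          · exact fun j _ => (hK x).mul (by fun_prop)
          · exact Finset.measurable_sum _ fun j _ => (hK x).mul (by fun_prop)
  have hm : ∀ j, Measurable fun s => ∫⁻ u, ‖heatFactor (α j) t s u‖ₑ *
      ENNReal.ofReal ((u - s) ^ 2) ∂gammaMeasure (α j + 1) 1 := fun j => by
    have h1 : Measurable fun p : ℝ × ℝ => ‖heatFactor (α j) t p.1 p.2‖ₑ :=
      ((measurable_heatFactor (α j)).comp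
        (by fun_prop : Measurable fun p : ℝ × ℝ => (t, p.1, p.2))).enorm
    exact Measurable.lintegral_prod_right' (f := fun p : ℝ × ℝ =>
      ‖heatFactor (α j) t p.1 p.2‖ₑ * ENNReal.ofReal ((p.2 - p.1) ^ 2)) (h1.mul (by fun_prop))
  calc heatOscillation α g t ≤ ∫⁻ x, (ε + C * ∑ j, ∫⁻ s, ‖heatFactor (α j) t (x j) s‖ₑ *
          ENNReal.ofReal ((s - x j) ^ 2) ∂gammaMeasure (α j + 1) 1) ∂laguerreMeasure α :=
        lintegral_mono_ae ((ae_mem_orthant α).mono hinner)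
    _ = _ := by
      rw [lintegral_add_left measurable_const, lintegral_const, measure_univ, mul_one,
        lintegral_const_mul, lintegral_finsetSum]
      · congr 3 with j
        rw [laguerreMeasure_eq_pi hα, displacement]
        exact (measurePreserving_eval (fun i => gammaMeasure (α i + 1) 1) j).lintegral_comp (hm j)
      · exact fun j _ => (hm j).comp (measurable_pi_apply j)
      · exact Finset.measurable_sum _ fun j _ => (hm j).comp (measurable_pi_apply j)

/-- A continuous function of compact support oscillates by at most `ε` plus a multiple of the
squared distance. -/
lemma exists_enorm_sub_le_of_hasCompactSupport {g : (Fin d → ℝ) → 𝕜} (hgc : Continuous g)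
    (hgs : HasCompactSupport g) {ε : ℝ} (hε : 0 < ε) :
    ∃ C : ℝ≥0∞, C ≠ ∞ ∧ ∀ x y, ‖g y - g x‖ₑ ≤
      ENNReal.ofReal ε + C * ∑ j, ENNReal.ofReal ((y j - x j) ^ 2) := by
  obtain ⟨M, hM⟩ := hgs.exists_bound_of_continuous hgc
  obtain ⟨δ, hδ, hu⟩ := Metric.uniformContinuous_iff.1
    (hgs.uniformContinuous_of_continuous hgc) ε hε
  have hM0 : 0 ≤ M := (norm_nonneg _).trans (hM 0)
  refine ⟨ENNReal.ofReal (2 * M / δ ^ 2), ENNReal.ofReal_ne_top, fun x y => ?_⟩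
  by_cases hxy : dist y x < δ
  · refine le_add_right ?_
    rw [← ofReal_norm, ← dist_eq_norm]
    exact ENNReal.ofReal_le_ofReal (hu hxy).le
  · refine le_add_left ?_
    have : ∃ j, δ ≤ dist (y j) (x j) := by
      by_contra! h
      exact hxy ((dist_pi_lt_iff hδ).2 h)
    obtain ⟨j, hj⟩ := this
    have hsq : δ ^ 2 ≤ (y j - x j) ^ 2 := by
      rw [← sq_abs (y j - x j)]
      rw [Real.dist_eq] at hj
      gcongr
    calc ‖g y - g x‖ₑ ≤ ENNReal.ofReal (2 * M) := by
          rw [← ofReal_norm]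
          refine ENNReal.ofReal_le_ofReal ((norm_sub_le _ _).trans ?_)
          linarith [hM x, hM y]
      _ ≤ ENNReal.ofReal (2 * M / δ ^ 2) * ENNReal.ofReal ((y j - x j) ^ 2) := by
          rw [← ENNReal.ofReal_mul (by positivity)]
          refine ENNReal.ofReal_le_ofReal ?_
          calc 2 * M = 2 * M / δ ^ 2 * δ ^ 2 := by field_simp
            _ ≤ _ := by gcongr
      _ ≤ _ := by
          gcongr
          exact Finset.single_le_sum (f := fun j => ENNReal.ofReal ((y j - x j) ^ 2))
            (fun _ _ => zero_le) (Finset.mem_univ j)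

lemma tendsto_heatOscillation (hα : ∀ i, -1 < α i) {f : (Fin d → ℝ) → 𝕜}
    (hf : StronglyMeasurable f) (hfi : Integrable f (laguerreMeasure α)) :
    Tendsto (heatOscillation α f) (𝓝[>] 0) (𝓝 0) := by
  have hμ := isProbabilityMeasure_laguerreMeasure hα
  rw [ENNReal.tendsto_nhds_zero]
  intro ε hε
  rcases eq_or_ne ε ∞ with rfl | hεt
  · simp
  have hε4 : ε / 4 ≠ 0 := by simp [hε.ne']
  have hε4t : ε / 4 ≠ ∞ := ENNReal.div_ne_top hεt (by simp)
  obtain ⟨g, hgs, hfg, hgc, -⟩ := hfi.exists_hasCompactSupport_lintegral_sub_le hε4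
  obtain ⟨C, hC, hgC⟩ := exists_enorm_sub_le_of_hasCompactSupport hgc hgs
    (ENNReal.toReal_pos hε4 hε4t)
  rw [ENNReal.ofReal_toReal hε4t] at hgC
  have hlim : Tendsto (fun t => C * ∑ j, displacement (α j) t) (𝓝[>] 0) (𝓝 0) := by
    have h1 : Tendsto (fun t => ∑ j, displacement (α j) t) (𝓝[>] 0) (𝓝 (∑ _j : Fin d, 0)) :=
      tendsto_finsetSum _ fun j _ => tendsto_displacement (hα j)
    simpa using ENNReal.Tendsto.const_mul h1 (Or.inr hC)
  filter_upwards [(ENNReal.tendsto_nhds_zero.1 hlim) (ε / 4) (pos_iff_ne_zero.2 hε4),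
    self_mem_nhdsWithin] with t h1 ht
  calc heatOscillation α f t
      ≤ heatOscillation α g t + 2 * ∫⁻ x, ‖f x - g x‖ₑ ∂laguerreMeasure α :=
        heatOscillation_le_add hα ht hf hgc.stronglyMeasurable
    _ ≤ (ε / 4 + ε / 4) + 2 * (ε / 4) := by
        gcongr
        exact (heatOscillation_le_displacement hα ht hgC).trans (by gcongr)
    _ = ε := by
        rw [← two_mul, ← two_mul, ← mul_assoc]
        norm_num
        exact ENNReal.mul_div_cancel (by norm_num) (by norm_num)

/-! ### The heat semigroup on bounded functions -/

lemma heatSemigroup_of_pos {t : ℝ} (ht : 0 < t) (f : (Fin d → ℝ) → 𝕜) (x : Fin d → ℝ) :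
    heatSemigroup α t f x = ∫ y, heatKernel α t x y • f y ∂laguerreMeasure α :=
  if_neg ht.ne'

lemma stronglyMeasurable_heatSemigroup (hα : ∀ i, -1 < α i) {f : (Fin d → ℝ) → 𝕜}
    (hf : StronglyMeasurable f) :
    StronglyMeasurable fun p : ℝ × (Fin d → ℝ) => heatSemigroup α p.1 f p.2 := by
  have hμ := isProbabilityMeasure_laguerreMeasure hα
  have h1 : Measurable fun p : (ℝ × (Fin d → ℝ)) × (Fin d → ℝ) => (p.1.1, p.1.2, p.2) := by
    fun_prop
  have h2 : StronglyMeasurable fun p : (ℝ × (Fin d → ℝ)) × (Fin d → ℝ) =>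
      heatKernel α p.1.1 p.1.2 p.2 • f p.2 :=
    ((measurable_heatKernel α).comp h1).stronglyMeasurable.smul (hf.comp_measurable measurable_snd)
  unfold heatSemigroup
  exact StronglyMeasurable.ite (measurable_fst (measurableSet_singleton 0))
    (hf.comp_measurable measurable_snd) h2.integral_prod_right'

lemma norm_heatSemigroup_le (hα : ∀ i, -1 < α i) {f : (Fin d → ℝ) → 𝕜} {M : ℝ}
    (hM : ∀ x, ‖f x‖ ≤ M) {t : ℝ} (ht : 0 < t) {x : Fin d → ℝ} (hx : x ∈ orthant d) :
    ‖heatSemigroup α t f x‖ ≤ M := by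
  rw [heatSemigroup_of_pos ht]
  refine (norm_integral_le_of_norm_le ((integrable_heatKernel hα ht hx).mul_const M)
    (Eventually.of_forall fun y => ?_)).trans_eq ?_
  · rw [norm_smul, Real.norm_of_nonneg (heatKernel_nonneg hα ht x y)]
    exact mul_le_mul_of_nonneg_left (hM y) (heatKernel_nonneg hα ht x y)
  · rw [integral_mul_const, integral_heatKernel hα ht hx, one_mul]

lemma integrable_heatKernel_smul (hα : ∀ i, -1 < α i) {f : (Fin d → ℝ) → 𝕜} {M : ℝ}
    (hf : StronglyMeasurable f) (hM : ∀ x, ‖f x‖ ≤ M) {t : ℝ} (ht : 0 < t) {x : Fin d → ℝ}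
    (hx : x ∈ orthant d) :
    Integrable (fun y => heatKernel α t x y • f y) (laguerreMeasure α) :=
  (integrable_heatKernel hα ht hx).smul_bdd M hf.aestronglyMeasurable (Eventually.of_forall hM)

lemma enorm_heatSemigroup_sub_le (hα : ∀ i, -1 < α i) {f : (Fin d → ℝ) → 𝕜} {M : ℝ}
    (hf : StronglyMeasurable f) (hM : ∀ x, ‖f x‖ ≤ M) {t : ℝ} (ht : 0 < t) {x : Fin d → ℝ}
    (hx : x ∈ orthant d) :
    ‖heatSemigroup α t f x - f x‖ₑ ≤
      ∫⁻ y, ‖heatKernel α t x y‖ₑ * ‖f y - f x‖ₑ ∂laguerreMeasure α := by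
  have h1 : f x = ∫ y, heatKernel α t x y • f x ∂laguerreMeasure α := by
    rw [integral_smul_const, integral_heatKernel hα ht hx, one_smul]
  rw [heatSemigroup_of_pos ht]
  nth_rewrite 1 [h1]
  rw [← integral_sub (integrable_heatKernel_smul hα hf hM ht hx)
    ((integrable_heatKernel hα ht hx).smul_const _)]
  simp_rw [← smul_sub]
  refine (enorm_integral_le_lintegral_enorm _).trans_eq ?_
  simp_rw [enorm_smul]

/-! ### Laplace transforms -/

/-- The Laplace transform of `v ^ c • h v`; differentiating it raises `c` by one and changes the
sign. -/
noncomputable def laplaceMoment (h : ℝ → 𝕜) (c σ : ℝ) : 𝕜 :=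
  ∫ v in Set.Ioi (0 : ℝ), (v ^ c * Real.exp (-(σ * v))) • h v

lemma integrableOn_rpow_mul_exp {c σ : ℝ} (hc : -1 < c) (hσ : 0 < σ) :
    IntegrableOn (fun v : ℝ => v ^ c * Real.exp (-(σ * v))) (Set.Ioi 0) := by
  have h := integrableOn_rpow_mul_exp_neg_mul_rpow hc one_pos hσ
  simpa only [Real.rpow_one, neg_mul] using h

lemma hasDerivAt_laplaceMoment {h : ℝ → 𝕜} {M : ℝ} (hh : StronglyMeasurable h)
    (hM : ∀ v, 0 < v → ‖h v‖ ≤ M) {c σ : ℝ} (hc : -1 < c) (hσ : 0 < σ) :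
    HasDerivAt (laplaceMoment h c) (-laplaceMoment h (c + 1) σ) σ := by
  have hmeas : ∀ c σ : ℝ, AEStronglyMeasurable (fun v : ℝ => (v ^ c * Real.exp (-(σ * v))) • h v)
      (volume.restrict (Set.Ioi 0)) := fun c σ =>
    ((by fun_prop : Measurable fun v : ℝ => v ^ c * Real.exp (-(σ * v))).stronglyMeasurable.smul
      hh).aestronglyMeasurable
  have hint : ∀ {c σ : ℝ}, -1 < c → 0 < σ →
      Integrable (fun v : ℝ => (v ^ c * Real.exp (-(σ * v))) • h v)
        (volume.restrict (Set.Ioi 0)) := fun hc hσ =>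
    (integrableOn_rpow_mul_exp hc hσ).smul_bdd M hh.aestronglyMeasurable
      ((ae_restrict_mem measurableSet_Ioi).mono fun v hv => hM v hv)
  have hbound : Integrable (fun v : ℝ => v ^ (c + 1) * Real.exp (-(σ / 2 * v)) * M)
      (volume.restrict (Set.Ioi 0)) :=
    (integrableOn_rpow_mul_exp (by linarith) (half_pos hσ)).mul_const M
  have key := hasDerivAt_integral_of_dominated_loc_of_deriv_le (𝕜 := ℝ)
    (μ := volume.restrict (Set.Ioi (0 : ℝ)))
    (F := fun σ v => (v ^ c * Real.exp (-(σ * v))) • h v)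
    (F' := fun σ v => -((v ^ (c + 1) * Real.exp (-(σ * v))) • h v))
    (Ioi_mem_nhds (half_lt_self hσ)) (Eventually.of_forall fun σ => hmeas c σ) (hint hc hσ)
    (hmeas (c + 1) σ).neg ?_ hbound ?_
  · convert! key.2 using 1
    rw [integral_neg, laplaceMoment]
  · filter_upwards [ae_restrict_mem measurableSet_Ioi] with v hv τ hτ
    have hv0 : 0 < v := hv
    have hτ' : σ / 2 < τ := hτ
    rw [norm_neg, norm_smul, Real.norm_of_nonneg (by positivity)]
    gcongr
    exact hM v hv
  · filter_upwards [ae_restrict_mem measurableSet_Ioi] with v hv τ _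
    have hv0 : 0 < v := hv
    have h1 : HasDerivAt (fun τ : ℝ => v ^ c * Real.exp (-(τ * v)))
        (v ^ c * (Real.exp (-(τ * v)) * -(1 * v))) τ :=
      ((((hasDerivAt_id τ).mul_const v).neg).exp).const_mul _
    convert! h1.smul_const (h v) using 1
    rw [← neg_smul, Real.rpow_add_one hv0.ne']
    congr 1
    ring

/-! ### The Poisson semigroup -/

lemma integral_exp_neg_div_sqrt :
    ∫ u in Set.Ioi (0 : ℝ), Real.exp (-u) / Real.sqrt u = Real.sqrt Real.pi := by
  rw [← Real.Gamma_one_half_eq, Real.Gamma_eq_integral one_half_pos]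
  refine setIntegral_congr_fun measurableSet_Ioi fun u hu => ?_
  have hu0 : 0 < u := hu
  rw [Real.sqrt_eq_rpow, div_eq_mul_inv, ← Real.rpow_neg hu0.le]
  norm_num

lemma integrableOn_exp_neg_div_sqrt :
    IntegrableOn (fun u : ℝ => Real.exp (-u) / Real.sqrt u) (Set.Ioi 0) := by
  by_contra h
  have h1 := integral_undef h
  rw [integral_exp_neg_div_sqrt] at h1
  exact (Real.sqrt_pos.2 Real.pi_pos).ne' h1

lemma poissonSemigroup_zero (f : (Fin d → ℝ) → 𝕜) (x : Fin d → ℝ) :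
    poissonSemigroup α 0 f x = f x := by
  have h : ∀ u : ℝ, heatSemigroup α (0 ^ 2 / (4 * u)) f x = f x := fun u => by
    simp [heatSemigroup]
  have hπ : Real.sqrt Real.pi ≠ 0 := (Real.sqrt_pos.2 Real.pi_pos).ne'
  simp_rw [poissonSemigroup, h]
  rw [integral_smul_const, integral_exp_neg_div_sqrt, smul_smul, one_div_mul_cancel hπ, one_smul]

lemma poissonSemigroup_congr {f g : (Fin d → ℝ) → 𝕜} (hfg : f =ᵐ[laguerreMeasure α] g) {s : ℝ}
    (hs : 0 < s) (x : Fin d → ℝ) : poissonSemigroup α s f x = poissonSemigroup α s g x := by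
  rw [poissonSemigroup, poissonSemigroup]
  congr 1
  refine setIntegral_congr_fun measurableSet_Ioi fun u hu => ?_
  have hu0 : 0 < u := hu
  have hr : 0 < s ^ 2 / (4 * u) := by positivity
  rw [heatSemigroup_of_pos hr, heatSemigroup_of_pos hr]
  congr 1
  exact integral_congr_ae (hfg.mono fun y hy => by simp only [hy])

/-- The substitution `u = s² v` turns the subordination formula into a Laplace transform at
`s²`. -/
lemma poissonSemigroup_eq_laplaceMoment (f : (Fin d → ℝ) → 𝕜) (x : Fin d → ℝ) {s : ℝ}
    (hs : 0 < s) :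
    poissonSemigroup α s f x = (s / Real.sqrt Real.pi) •
      laplaceMoment (fun v => heatSemigroup α (1 / (4 * v)) f x) (-(1 / 2)) (s ^ 2) := by
  have h := integral_comp_mul_left_Ioi' (fun u : ℝ => (Real.exp (-u) / Real.sqrt u) •
    heatSemigroup α (s ^ 2 / (4 * u)) f x) 0 (sq_pos_of_pos hs)
  rw [mul_zero] at h
  have h' : ∫ v in Set.Ioi (0 : ℝ), (Real.exp (-(s ^ 2 * v)) / Real.sqrt (s ^ 2 * v)) •
      heatSemigroup α (s ^ 2 / (4 * (s ^ 2 * v))) f x =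
      s⁻¹ • laplaceMoment (fun v => heatSemigroup α (1 / (4 * v)) f x) (-(1 / 2)) (s ^ 2) := by
    rw [laplaceMoment, ← integral_smul]
    refine setIntegral_congr_fun measurableSet_Ioi fun v hv => ?_
    have hv0 : 0 < v := hv
    rw [smul_smul, Real.sqrt_mul (sq_nonneg s), Real.sqrt_sq hs.le, Real.rpow_neg hv0.le,
      ← Real.sqrt_eq_rpow]
    congr 1
    · field_simp
    · congr 1
      field_simp
  rw [poissonSemigroup, ← h, h', smul_smul, smul_smul]
  congr 1
  field_simp

lemma stronglyMeasurable_heatSemigroup_one_div (hα : ∀ i, -1 < α i) {f : (Fin d → ℝ) → 𝕜}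
    (hf : StronglyMeasurable f) (x : Fin d → ℝ) :
    StronglyMeasurable fun v : ℝ => heatSemigroup α (1 / (4 * v)) f x :=
  (stronglyMeasurable_heatSemigroup hα hf).comp_measurable
    (by fun_prop : Measurable fun v : ℝ => (1 / (4 * v), x))

/-- For a bounded function the Poisson integral is continuously differentiable in time, at every
point of the orthant. -/
lemma exists_hasDerivAt_poissonSemigroup (hα : ∀ i, -1 < α i) {f : (Fin d → ℝ) → 𝕜} {M : ℝ}
    (hf : StronglyMeasurable f) (hM : ∀ x, ‖f x‖ ≤ M) {x : Fin d → ℝ} (hx : x ∈ orthant d) :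
    ∃ D : ℝ → 𝕜, ContinuousOn D (Set.Ioi 0) ∧
      ∀ s, 0 < s → HasDerivAt (fun s => poissonSemigroup α s f x) (D s) s := by
  set h : ℝ → 𝕜 := fun v => heatSemigroup α (1 / (4 * v)) f x with hh
  have hm : StronglyMeasurable h := stronglyMeasurable_heatSemigroup_one_div hα hf x
  have hb : ∀ v, 0 < v → ‖h v‖ ≤ M := fun v hv =>
    norm_heatSemigroup_le hα hM (by positivity) hx
  have hL : ∀ {c s : ℝ}, -1 < c → 0 < s → HasDerivAt (fun s => laplaceMoment h c (s ^ 2))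
      ((2 * s) • -laplaceMoment h (c + 1) (s ^ 2)) s := fun {c s} hc hs => by
    have h1 : HasDerivAt (fun s : ℝ => s ^ 2) (2 * s) s := by simpa using hasDerivAt_pow 2 s
    exact HasDerivAt.scomp s (h := fun s : ℝ => s ^ 2)
      (hasDerivAt_laplaceMoment hm hb hc (sq_pos_of_pos hs)) h1
  refine ⟨fun s => (s / Real.sqrt Real.pi) • ((2 * s) • -laplaceMoment h (-(1 / 2) + 1) (s ^ 2)) +
    (1 / Real.sqrt Real.pi) • laplaceMoment h (-(1 / 2)) (s ^ 2), ?_, fun s hs => ?_⟩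
  · intro s hs
    have hc1 := (hL (c := -(1 / 2)) (by norm_num) hs).continuousAt
    have hc2 := (hL (c := -(1 / 2) + 1) (by norm_num) hs).continuousAt
    refine ContinuousAt.continuousWithinAt ?_
    have e1 : ContinuousAt (fun s : ℝ => s / Real.sqrt Real.pi) s := by fun_prop
    have e2 : ContinuousAt (fun s : ℝ => 2 * s) s := by fun_prop
    exact (e1.smul (e2.smul hc2.neg)).add (continuousAt_const.smul hc1)
  · have h1 := ((hasDerivAt_id s).div_const (Real.sqrt Real.pi)).smul
      (hL (c := -(1 / 2)) (by norm_num) hs)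
    refine HasDerivAt.congr_of_eventuallyEq h1 ?_
    filter_upwards [Ioi_mem_nhds hs] with r hr
    exact poissonSemigroup_eq_laplaceMoment f x hr

/-! ### Convergence to the initial datum in mean -/

lemma stronglyMeasurable_poissonSemigroup (hα : ∀ i, -1 < α i) {f : (Fin d → ℝ) → 𝕜}
    (hf : StronglyMeasurable f) (s : ℝ) :
    StronglyMeasurable (poissonSemigroup α s f) := by
  have h1 : StronglyMeasurable fun p : (Fin d → ℝ) × ℝ =>
      (Real.exp (-p.2) / Real.sqrt p.2) • heatSemigroup α (s ^ 2 / (4 * p.2)) f p.1 :=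
    (by fun_prop : Measurable fun p : (Fin d → ℝ) × ℝ =>
      Real.exp (-p.2) / Real.sqrt p.2).stronglyMeasurable.smul
      ((stronglyMeasurable_heatSemigroup hα hf).comp_measurable
        (by fun_prop : Measurable fun p : (Fin d → ℝ) × ℝ => (s ^ 2 / (4 * p.2), p.1)))
  exact h1.integral_prod_right'.const_smul (1 / Real.sqrt Real.pi)

/-- The probability density `e^{-u} / √(π u)` on `(0, ∞)` of the subordination formula, with values
in `ℝ≥0∞`. -/
noncomputable def subordinationWeight (u : ℝ) : ℝ≥0∞ :=
  ENNReal.ofReal (1 / Real.sqrt Real.pi * (Real.exp (-u) / Real.sqrt u))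

lemma measurable_subordinationWeight : Measurable subordinationWeight := by
  unfold subordinationWeight
  fun_prop

lemma lintegral_subordinationWeight_ne_top :
    ∫⁻ u in Set.Ioi (0 : ℝ), subordinationWeight u ≠ ∞ :=
  ((integrableOn_exp_neg_div_sqrt.const_mul _).lintegral_lt_top).ne

lemma enorm_poissonSemigroup_sub_le (hα : ∀ i, -1 < α i) {f : (Fin d → ℝ) → 𝕜} {M : ℝ}
    (hf : StronglyMeasurable f) (hM : ∀ x, ‖f x‖ ≤ M) {s : ℝ} (hs : 0 < s) {x : Fin d → ℝ}
    (hx : x ∈ orthant d) :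
    ‖poissonSemigroup α s f x - f x‖ₑ ≤ ∫⁻ u in Set.Ioi (0 : ℝ), subordinationWeight u *
      ∫⁻ y, ‖heatKernel α (s ^ 2 / (4 * u)) x y‖ₑ * ‖f y - f x‖ₑ ∂laguerreMeasure α := by
  have hπ : 0 < Real.sqrt Real.pi := Real.sqrt_pos.2 Real.pi_pos
  have hint : Integrable (fun u : ℝ => (Real.exp (-u) / Real.sqrt u) •
      heatSemigroup α (s ^ 2 / (4 * u)) f x) (volume.restrict (Set.Ioi 0)) := by
    refine integrableOn_exp_neg_div_sqrt.integrable.smul_bdd M ?_ ?_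
    · exact ((stronglyMeasurable_heatSemigroup hα hf).comp_measurable (by fun_prop :
        Measurable fun u : ℝ => (s ^ 2 / (4 * u), x))).aestronglyMeasurable
    · filter_upwards [ae_restrict_mem measurableSet_Ioi] with u hu
      have hu0 : 0 < u := hu
      exact norm_heatSemigroup_le hα hM (by positivity) hx
  have h1 : f x = (1 / Real.sqrt Real.pi) •
      ∫ u in Set.Ioi (0 : ℝ), (Real.exp (-u) / Real.sqrt u) • f x := by
    rw [integral_smul_const, integral_exp_neg_div_sqrt, smul_smul, one_div_mul_cancel hπ.ne',
      one_smul]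
  rw [poissonSemigroup]
  nth_rewrite 1 [h1]
  rw [← smul_sub, ← integral_sub hint (integrableOn_exp_neg_div_sqrt.smul_const _),
    ← integral_smul]
  refine (enorm_integral_le_lintegral_enorm _).trans ?_
  refine setLIntegral_mono' measurableSet_Ioi fun u hu => ?_
  have hu0 : 0 < u := hu
  rw [← smul_sub, smul_smul, enorm_smul, Real.enorm_of_nonneg (by positivity),
    subordinationWeight]
  gcongr
  exact enorm_heatSemigroup_sub_le hα hf hM (by positivity) hx

lemma measurable_lintegral_oscillation (hα : ∀ i, -1 < α i) {f : (Fin d → ℝ) → 𝕜}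
    (hf : StronglyMeasurable f) : Measurable fun p : ℝ × (Fin d → ℝ) =>
      ∫⁻ y, ‖heatKernel α p.1 p.2 y‖ₑ * ‖f y - f p.2‖ₑ ∂laguerreMeasure α := by
  have hμ := isProbabilityMeasure_laguerreMeasure hα
  have h1 : Measurable fun p : (ℝ × (Fin d → ℝ)) × (Fin d → ℝ) => (p.1.1, p.1.2, p.2) := by
    fun_prop
  have h2 := ((measurable_heatKernel α).comp h1).enorm
  have h3 : StronglyMeasurable fun p : (ℝ × (Fin d → ℝ)) × (Fin d → ℝ) => f p.2 - f p.1.2 :=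
    (hf.comp_measurable (by fun_prop)).sub (hf.comp_measurable (by fun_prop))
  exact (h2.mul h3.enorm).lintegral_prod_right'

lemma lintegral_enorm_poissonSemigroup_sub_le (hα : ∀ i, -1 < α i) {f : (Fin d → ℝ) → 𝕜} {M : ℝ}
    (hf : StronglyMeasurable f) (hM : ∀ x, ‖f x‖ ≤ M) {s : ℝ} (hs : 0 < s) :
    ∫⁻ x, ‖poissonSemigroup α s f x - f x‖ₑ ∂laguerreMeasure α ≤
      ∫⁻ u in Set.Ioi (0 : ℝ), subordinationWeight u * heatOscillation α f (s ^ 2 / (4 * u)) := by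
  have hμ := isProbabilityMeasure_laguerreMeasure hα
  have hm := measurable_lintegral_oscillation hα hf
  have hw := measurable_subordinationWeight
  refine (lintegral_mono_ae ((ae_mem_orthant α).mono fun x hx =>
    enorm_poissonSemigroup_sub_le hα hf hM hs hx)).trans_eq ?_
  rw [lintegral_lintegral_swap]
  · refine lintegral_congr fun u => ?_
    have h1 : Measurable fun x : Fin d → ℝ => (s ^ 2 / (4 * u), x) := by fun_prop
    have h2 := hm.comp h1
    exact lintegral_const_mul _ h2
  · have h1 : Measurable fun p : (Fin d → ℝ) × ℝ => (s ^ 2 / (4 * p.2), p.1) := by fun_prop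
    have h2 := hm.comp h1
    have h3 := hw.comp (measurable_snd : Measurable fun p : (Fin d → ℝ) × ℝ => p.2)
    exact (h3.mul h2).aemeasurable

/-- The Poisson integrals of a bounded function converge to it in `L¹`. -/
lemma tendsto_lintegral_enorm_poissonSemigroup_sub (hα : ∀ i, -1 < α i) {f : (Fin d → ℝ) → 𝕜}
    {M : ℝ} (hf : StronglyMeasurable f) (hM : ∀ x, ‖f x‖ ≤ M) :
    Tendsto (fun s => ∫⁻ x, ‖poissonSemigroup α s f x - f x‖ₑ ∂laguerreMeasure α)
      (𝓝[>] 0) (𝓝 0) := by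
  have hμ := isProbabilityMeasure_laguerreMeasure hα
  have hfi : Integrable f (laguerreMeasure α) :=
    Integrable.of_bound hf.aestronglyMeasurable M (Eventually.of_forall hM)
  have hw := measurable_subordinationWeight
  have hosc : Measurable (heatOscillation α f) :=
    (measurable_lintegral_oscillation hα hf).lintegral_prod_right'
  have hlim : Tendsto (fun s : ℝ => ∫⁻ u in Set.Ioi (0 : ℝ), subordinationWeight u *
      heatOscillation α f (s ^ 2 / (4 * u))) (𝓝[>] 0) (𝓝 (∫⁻ _ in Set.Ioi (0 : ℝ), 0)) := by
    refine tendsto_lintegral_filter_of_dominated_convergence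
      (fun u => subordinationWeight u * (2 * ∫⁻ x, ‖f x‖ₑ ∂laguerreMeasure α)) ?_ ?_ ?_ ?_
    · exact Eventually.of_forall fun s => hw.mul (hosc.comp (by fun_prop))
    · filter_upwards [self_mem_nhdsWithin] with s hs
      filter_upwards [ae_restrict_mem measurableSet_Ioi] with u hu
      have hu0 : 0 < u := hu
      have hs0 : 0 < s := hs
      gcongr
      exact heatOscillation_le hα (by positivity) hf
    · rw [lintegral_mul_const _ hw]
      exact ENNReal.mul_ne_top lintegral_subordinationWeight_ne_top
        (ENNReal.mul_ne_top (by simp) hfi.2.ne)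
    · filter_upwards [ae_restrict_mem measurableSet_Ioi] with u hu
      have hu0 : 0 < u := hu
      have h1 : Tendsto (fun s : ℝ => s ^ 2 / (4 * u)) (𝓝[>] 0) (𝓝[>] 0) := by
        refine tendsto_nhdsWithin_iff.2 ⟨?_, ?_⟩
        · have hc : Continuous fun s : ℝ => s ^ 2 / (4 * u) := by fun_prop
          have h2 := hc.tendsto 0
          simp only [ne_eq, OfNat.ofNat_ne_zero, not_false_eq_true, zero_pow, zero_div] at h2
          exact h2.mono_left nhdsWithin_le_nhds
        · filter_upwards [self_mem_nhdsWithin] with s hs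
          have hs0 : 0 < s := hs
          exact Set.mem_Ioi.2 (by positivity)
      have h2 := ENNReal.Tendsto.const_mul ((tendsto_heatOscillation hα hf hfi).comp h1)
        (Or.inr (ENNReal.ofReal_ne_top : subordinationWeight u ≠ ∞))
      rwa [mul_zero] at h2
  rw [lintegral_zero] at hlim
  exact tendsto_of_tendsto_of_tendsto_of_le_of_le' tendsto_const_nhds hlim
    (Eventually.of_forall fun _ => zero_le)
    (eventually_mem_nhdsWithin.mono fun s hs => lintegral_enorm_poissonSemigroup_sub_le hα hf hM hs)

/-! ### From the derivative bound to the Hölder bound -/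

/-- An essentially bounded function agrees almost everywhere with a measurable function bounded at
every point. -/
lemma exists_stronglyMeasurable_bounded {f : (Fin d → ℝ) → 𝕜} {μ : Measure (Fin d → ℝ)}
    (hf : MemLp f ∞ μ) :
    ∃ (g : (Fin d → ℝ) → 𝕜) (M : ℝ), StronglyMeasurable g ∧ (∀ x, ‖g x‖ ≤ M) ∧ f =ᵐ[μ] g := by
  have hm := hf.1.stronglyMeasurable_mk
  set M := (eLpNormEssSup f μ).toReal with hMdef
  have hM0 : 0 ≤ M := ENNReal.toReal_nonneg
  have hS : MeasurableSet {x | ‖hf.1.mk f x‖ ≤ M} :=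
    measurableSet_le hm.norm.measurable measurable_const
  refine ⟨{x | ‖hf.1.mk f x‖ ≤ M}.indicator (hf.1.mk f), M, hm.indicator hS, fun x => ?_, ?_⟩
  · by_cases hx : x ∈ {x | ‖hf.1.mk f x‖ ≤ M}
    · rw [Set.indicator_of_mem hx]
      exact hx
    · rw [Set.indicator_of_notMem hx, norm_zero]
      exact hM0
  · have hfin : eLpNormEssSup f μ ≠ ∞ := by
      have := hf.2.ne
      rwa [eLpNorm_exponent_top] at this
    filter_upwards [hf.1.ae_eq_mk, enorm_ae_le_eLpNormEssSup f μ] with x h1 h2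
    have h3 : ‖hf.1.mk f x‖ ≤ M := by
      rw [← h1, ← toReal_enorm]
      exact ENNReal.toReal_mono hfin h2
    rw [Set.indicator_of_mem (show x ∈ {x | ‖hf.1.mk f x‖ ≤ M} from h3), h1]

/-- Integrating the bound `‖F'(s)‖ ≤ A s ^ (β - 1)`. -/
lemma norm_sub_le_of_norm_deriv_le {F D : ℝ → 𝕜} {A β : ℝ} (hβ : 0 < β) (hA : 0 ≤ A)
    (hF : ∀ s, 0 < s → HasDerivAt F (D s) s) (hD : ∀ s, 0 < s → ‖D s‖ ≤ A * s ^ (β - 1))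
    {s t : ℝ} (hs : 0 < s) (hst : s ≤ t) : ‖F t - F s‖ ≤ A / β * t ^ β := by
  have hB : ∀ r, 0 < r → HasDerivAt (fun r : ℝ => A / β * r ^ β - A / β * s ^ β)
      (A * r ^ (β - 1)) r := fun r hr => by
    convert! ((Real.hasDerivAt_rpow_const (p := β) (Or.inl hr.ne')).const_mul (A / β)).sub_const _
      using 1
    field_simp
  have hpos : ∀ r ∈ Set.Icc s t, 0 < r := fun r hr => hs.trans_le hr.1
  have key := image_norm_le_of_norm_deriv_right_le_deriv_boundary' (f := fun r => F r - F s)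
    (f' := D) (a := s) (b := t) (B := fun r : ℝ => A / β * r ^ β - A / β * s ^ β)
    (B' := fun r => A * r ^ (β - 1))
    (fun r hr => ((hF r (hpos r hr)).sub_const _).continuousAt.continuousWithinAt)
    (fun r hr => ((hF r (hs.trans_le hr.1)).sub_const _).hasDerivWithinAt) (by simp)
    (fun r hr => (hB r (hpos r hr)).continuousAt.continuousWithinAt)
    (fun r hr => (hB r (hs.trans_le hr.1)).hasDerivWithinAt)
    (fun r hr => hD r (hs.trans_le hr.1)) (Set.right_mem_Icc.2 hst)
  have : 0 ≤ A / β * s ^ β := by positivity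
  linarith

/-- An admissible constant bounds the time derivative at almost every point simultaneously for all
times: the exceptional sets are only collected over rational times, and the derivative is
continuous in time. -/
lemma ae_norm_deriv_le (hα : ∀ i, -1 < α i) {β : ℝ} (hβ1 : β < 1)
    {f : (Fin d → ℝ) → 𝕜} {M : ℝ} (hf : StronglyMeasurable f) (hM : ∀ x, ‖f x‖ ≤ M) {A : ℝ}
    (hA : IsLipBound α β f A) :
    ∀ᵐ x ∂laguerreMeasure α, ∀ s, 0 < s →
      ‖deriv (fun s => poissonSemigroup α s f x) s‖ ≤ A * s ^ (β - 1) := by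
  have hfl : ⌊β⌋₊ = 0 := Nat.floor_eq_zero.2 hβ1
  have hrat : ∀ r : ℚ, 0 < (r : ℝ) → ∀ᵐ x ∂laguerreMeasure α,
      ‖deriv (fun s => poissonSemigroup α s f x) r‖ ≤ A * (r : ℝ) ^ (β - 1) := by
    intro r hr
    have h1 := hA.2 r hr
    simp only [hfl, zero_add, iteratedDeriv_one, eLpNorm_exponent_top, Nat.cast_one] at h1
    filter_upwards [enorm_ae_le_eLpNormEssSup
      (fun x => deriv (fun s => poissonSemigroup α s f x) r) (laguerreMeasure α)] with x hx
    have h2 := hx.trans h1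
    rw [← ofReal_norm, neg_add_eq_sub,
      ENNReal.ofReal_le_ofReal_iff (mul_nonneg hA.1 (by positivity))] at h2
    exact h2
  have hall : ∀ᵐ x ∂laguerreMeasure α, ∀ r : ℚ, 0 < (r : ℝ) →
      ‖deriv (fun s => poissonSemigroup α s f x) r‖ ≤ A * (r : ℝ) ^ (β - 1) := by
    rw [ae_all_iff]
    intro r
    by_cases hr : 0 < (r : ℝ)
    · exact (hrat r hr).mono fun x hx _ => hx
    · exact Eventually.of_forall fun x h => absurd h hr
  filter_upwards [hall, ae_mem_orthant α] with x hx hxo s hs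
  obtain ⟨D, hDc, hD⟩ := exists_hasDerivAt_poissonSemigroup hα hf hM hxo
  have hcl : s ∈ closure (Set.Ioi (0 : ℝ) ∩ Set.range ((↑) : ℚ → ℝ)) :=
    (Rat.denseRange_cast (𝕜 := ℝ)).open_subset_closure_inter isOpen_Ioi hs
  have hmem := mem_closure_iff_frequently.1 hcl
  rw [(hD s hs).deriv]
  have hc1 : ContinuousAt D s := hDc.continuousAt (Ioi_mem_nhds hs)
  have hc2 : ContinuousAt (fun s : ℝ => A * s ^ (β - 1)) s :=
    continuousAt_const.mul (Real.continuousAt_rpow_const _ _ (Or.inl hs.ne'))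
  by_contra! hlt
  obtain ⟨r, ⟨hr0, q, rfl⟩, hr⟩ := (hmem.and_eventually (hc2.eventually_lt hc1.norm hlt)).exists
  have h3 := hx q hr0
  rw [(hD q hr0).deriv] at h3
  exact absurd h3 (not_le.2 hr)

lemma isLipBound_congr {β : ℝ} {f g : (Fin d → ℝ) → 𝕜} (hfg : f =ᵐ[laguerreMeasure α] g) {A : ℝ}
    (hA : IsLipBound α β f A) : IsLipBound α β g A := by
  refine ⟨hA.1, fun t ht => ?_⟩
  have h : ∀ x, iteratedDeriv (⌊β⌋₊ + 1) (fun s : ℝ => poissonSemigroup α s g x) t =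
      iteratedDeriv (⌊β⌋₊ + 1) (fun s : ℝ => poissonSemigroup α s f x) t := fun x => by
    refine Filter.EventuallyEq.iteratedDeriv_eq _ ?_
    filter_upwards [Ioi_mem_nhds ht] with s hs
    exact (poissonSemigroup_congr hfg hs x).symm
  simp_rw [h]
  exact hA.2 t ht

lemma eLpNorm_poissonSemigroup_sub_le (hα : ∀ i, -1 < α i) {β : ℝ} (hβ0 : 0 < β) (hβ1 : β < 1)
    {f : (Fin d → ℝ) → 𝕜} {M : ℝ} (hf : StronglyMeasurable f) (hM : ∀ x, ‖f x‖ ≤ M) {A : ℝ}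
    (hA : IsLipBound α β f A) {t : ℝ} (ht : 0 < t) :
    eLpNorm (fun x => poissonSemigroup α t f x - f x) ∞ (laguerreMeasure α) ≤
      ENNReal.ofReal (A / β * t ^ β) := by
  have hμ := isProbabilityMeasure_laguerreMeasure hα
  have hconv : TendstoInMeasure (laguerreMeasure α) (fun s => poissonSemigroup α s f) (𝓝[>] 0) f :=
    tendstoInMeasure_of_tendsto_eLpNorm one_ne_zero
      (fun s => (stronglyMeasurable_poissonSemigroup hα hf s).aestronglyMeasurable)
      hf.aestronglyMeasurable (by
        simp_rw [eLpNorm_one_eq_lintegral_enorm]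
        exact tendsto_lintegral_enorm_poissonSemigroup_sub hα hf hM)
  obtain ⟨ns, hns, hlim⟩ := hconv.exists_seq_tendsto_ae'
  rw [eLpNorm_exponent_top]
  refine eLpNormEssSup_le_of_ae_enorm_bound ?_
  filter_upwards [hlim, ae_norm_deriv_le hα hβ1 hf hM hA, ae_mem_orthant α] with x hx hd hxo
  obtain ⟨D, -, hD⟩ := exists_hasDerivAt_poissonSemigroup hα hf hM hxo
  have hD' : ∀ s, 0 < s → ‖D s‖ ≤ A * s ^ (β - 1) := fun s hs => by
    rw [← (hD s hs).deriv]
    exact hd s hs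
  rw [← ofReal_norm]
  refine ENNReal.ofReal_le_ofReal (le_of_tendsto ((tendsto_const_nhds.sub hx).norm) ?_)
  have h0 : ∀ᶠ i in atTop, ns i ∈ Set.Ioo 0 t := hns.eventually (Ioo_mem_nhdsGT ht)
  filter_upwards [h0] with i hi
  exact norm_sub_le_of_norm_deriv_le hβ0 hA.1 hD hD' hi.1 hi.2.le

end Laguerre

open Laguerre in
theorem proposition3p3 {𝕜 : Type*} [RCLike 𝕜] {d : ℕ} (α : Fin d → ℝ) (hα : ∀ i, -1 < α i)
    (β : ℝ) (hβ0 : 0 < β) (hβ1 : β < 1) (f : (Fin d → ℝ) → 𝕜) (hf : Laguerre.MemLip α β f)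
    (t : ℝ) (ht : 0 ≤ t) :
    eLpNorm (fun x => Laguerre.poissonSemigroup α t f x - f x) ∞ (Laguerre.laguerreMeasure α) ≤
      ENNReal.ofReal (Laguerre.lipConst α β f / β * t ^ β) := by
  rcases ht.eq_or_lt with rfl | ht
  · simp only [poissonSemigroup_zero, sub_self]
    exact (eLpNorm_zero' (ε := 𝕜)).trans_le zero_le
  obtain ⟨hfL, A, hA⟩ := hf
  obtain ⟨g, M, hg, hM, hfg⟩ := exists_stronglyMeasurable_bounded hfL
  have hcongr : (fun x => poissonSemigroup α t f x - f x) =ᵐ[laguerreMeasure α]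
      fun x => poissonSemigroup α t g x - g x :=
    hfg.mono fun x hx => by simp only [poissonSemigroup_congr hfg ht x, hx]
  rw [eLpNorm_congr_ae hcongr]
  -- the bound holds for every admissible constant, hence for their infimum
  obtain ⟨u, -, hu, hmem⟩ := exists_seq_tendsto_sInf (S := {A | IsLipBound α β f A}) ⟨A, hA⟩
    ⟨0, fun _ hB => hB.1⟩
  refine ge_of_tendsto' (ENNReal.tendsto_ofReal ((hu.div_const β).mul_const (t ^ β))) fun n => ?_
  exact eLpNorm_poissonSemigroup_sub_le hα hβ0 hβ1 hg hM (isLipBound_congr hfg (hmem n)) ht
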